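/- Let $0<z<\frac{\pi}{2}$. For integers $0\le k<m$ define the normalized log-sine integral $$\mathrm{ls}_m^{(k)}(z)=-\int_0^z t^k\Bigl(\log\frac{\sin t}{\sin z}\Bigr)^{m-1-k}\,dt .$$ For integers $m,k\ge 1$ and $x\in\mathbb{C}\setminus[1,\infty)$ let $$S_{m,k}(x)=\frac{(-1)^{m+k-1}}{(m-1)!\,k!}\int_0^1 (\log t)^{m-1}\bigl(\log(1-xt)\bigr)^{k}\,\frac{dt}{t}$$ (principal branch of the logarithm) be the Nielsen polylogarithm, let $\mathrm{Li}_m$ be the classical polylogarithm, i.e. the analytic continuation to $\mathbb{C}\setminus[1,\infty)$ of $\sum_{n\ge1}x^n n^{-m}$ ($|x|<1$), and let $\zeta$ be the Riemann zeta function. Then $$\mathrm{ls}_5^{(0)}(z) = -\frac{z^5}{5} + 3\,\mathrm{Im}\, S_{3,2}(1-e^{-2iz}) -12\,\mathrm{Im}\,\mathrm{Li}_5(1-e^{-2iz}) - 6z\,\mathrm{Re}\,\mathrm{Li}_4(1-e^{-2iz}),$$ $$\mathrm{ls}_5^{(2)}(z) = -\frac{7z^5}{30} + \frac12\,\mathrm{Im}\,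 S_{3,2}(1-e^{-2iz}) + z\,\mathrm{Re}\,\mathrm{Li}_4(1-e^{-2iz}) - z^2\,\mathrm{Im}\,\mathrm{Li}_3(1-e^{-2iz}),$$ $$\begin{aligned}\mathrm{ls}_6^{(0)}(z) ={}& z^5\log(2\sin z) +5z^3\zeta(3)-\frac{15z}{2}\zeta(5) -15\,\mathrm{Im}\, S_{4,2}(1-e^{-2iz})\\&-\frac{15}{4}\bigl(\mathrm{Im}\,\mathrm{Li}_6(e^{-2iz})-16\,\mathrm{Im}\,\mathrm{Li}_6(1-e^{-2iz})\bigr) +30z\,\mathrm{Re}\,\mathrm{Li}_5(1-e^{-2iz}).\end{aligned}$$ -/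

import Mathlib

open MeasureTheory Set

/-- The normalized log-sine integral
`ls_m^{(k)}(z) = -∫_0^z t^k (log (sin t / sin z))^(m-1-k) dt`, for `0 ≤ k < m` and
`0 < z ≤ π/2` (natural-number subtraction in the exponent is genuine in this range). -/
noncomputable def logSine (m k : ℕ) (z : ℝ) : ℝ :=
  -∫ t in (0 : ℝ)..z, t ^ k * Real.log (Real.sin t / Real.sin z) ^ (m - 1 - k)

/-- The Nielsen polylogarithm
`S_{m,k}(x) = (-1)^(m+k-1) / ((m-1)! k!) ∫_0^1 (log t)^(m-1) (log (1 - x t))^k dt / t`,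
for `m, k ≥ 1` and `x ∉ [1, ∞)`, with the principal branch of the logarithm. -/
noncomputable def nielsenS (m k : ℕ) (x : ℂ) : ℂ :=
  (-1) ^ (m + k - 1) / (((m - 1).factorial : ℂ) * (k.factorial : ℂ)) *
    ∫ t in (0 : ℝ)..1, (Real.log t : ℂ) ^ (m - 1) * Complex.log (1 - x * t) ^ k / (t : ℂ)

/-- The classical polylogarithm `Li_m`, `m ≥ 1`, on the cut plane `ℂ \ [1, ∞)`:
the principal branch of the analytic continuation of `∑_{n ≥ 1} x^n / n^m`, given by
`Li_m(x) = (x / (m-1)!) ∫_0^∞ u^(m-1) / (e^u - x) du`.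
See `polylog_hasSum` (series in the unit disc) and `polylog_differentiableOn` (holomorphy on the
cut plane), which together characterize it. -/
noncomputable def polylog (m : ℕ) (x : ℂ) : ℂ :=
  x / ((m - 1).factorial : ℂ) *
    ∫ u in Ioi (0 : ℝ), (u : ℂ) ^ (m - 1) / (Complex.exp (u : ℂ) - x)

theorem integrableOn_pow_mul_exp_neg (m : ℕ) :
    IntegrableOn (fun u : ℝ => u ^ m * Real.exp (-u)) (Ioi 0) := by
  have h := Real.GammaIntegral_convergent (s := (m : ℝ) + 1) (by positivity)
  refine h.congr_fun (fun u hu => ?_) measurableSet_Ioi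
  simp [mul_comm]

theorem polylog_hasSum {m : ℕ} (hm : 1 ≤ m) {x : ℂ} (hx : ‖x‖ < 1) :
    HasSum (fun n : ℕ => x ^ (n + 1) / ((n : ℂ) + 1) ^ m) (polylog m x) := by
  obtain ⟨m, rfl⟩ := Nat.exists_eq_add_of_le' hm
  have hint : ∀ n : ℕ, ∫ u in Ioi (0 : ℝ), u ^ m * Real.exp (-((n : ℝ) + 1) * u)
      = m.factorial / ((n : ℝ) + 1) ^ (m + 1) := by
    intro n
    have h := Real.integral_rpow_mul_exp_neg_mul_Ioi (a := (m : ℝ) + 1) (r := (n : ℝ) + 1)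
      (by positivity) (by positivity)
    rw [Real.Gamma_nat_eq_factorial] at h
    have e : ((m : ℝ) + 1) = ((m + 1 : ℕ) : ℝ) := by push_cast; rfl
    rw [e, Real.rpow_natCast] at h
    rw [div_eq_inv_mul, ← inv_pow, ← one_div, ← h]
    refine setIntegral_congr_fun measurableSet_Ioi (fun u _ => ?_)
    have e1 : ((m + 1 : ℕ) : ℝ) - 1 = (m : ℝ) := by push_cast; ring
    simp only [e1, Real.rpow_natCast, neg_mul]
  have hI : ∀ n : ℕ, IntegrableOn (fun u : ℝ => u ^ m * Real.exp (-((n : ℝ) + 1) * u)) (Ioi 0) := by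
    intro n
    by_contra hc
    have h0 := hint n
    rw [integral_undef hc] at h0
    have : (0 : ℝ) < m.factorial / ((n : ℝ) + 1) ^ (m + 1) := by positivity
    linarith
  set F : ℕ → ℝ → ℂ := fun n u =>
    x ^ (n + 1) * ((u ^ m * Real.exp (-((n : ℝ) + 1) * u) : ℝ) : ℂ) with hF
  have hFi : ∀ n, Integrable (F n) (volume.restrict (Ioi 0)) := fun n =>
    ((hI n).ofReal).const_mul _
  have hFn : ∀ n, ∫ u in Ioi (0 : ℝ), ‖F n u‖
      = ‖x‖ ^ (n + 1) * (m.factorial / ((n : ℝ) + 1) ^ (m + 1)) := by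
    intro n
    rw [← hint n, ← integral_const_mul]
    refine setIntegral_congr_fun measurableSet_Ioi (fun u hu => ?_)
    have hu' : (0 : ℝ) < u := hu
    simp only [hF, norm_mul, norm_pow, Complex.norm_real, Real.norm_eq_abs]
    rw [abs_of_pos hu', abs_of_pos (Real.exp_pos _)]
  have hs : Summable fun n => ∫ u in Ioi (0 : ℝ), ‖F n u‖ := by
    simp_rw [hFn]
    refine Summable.of_nonneg_of_le (fun n => by positivity) (fun n => ?_)
      ((summable_geometric_of_lt_one (norm_nonneg x) hx).mul_right (m.factorial : ℝ))
    have h1 : ‖x‖ ^ (n + 1) ≤ ‖x‖ ^ n :=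
      pow_le_pow_of_le_one (norm_nonneg x) hx.le (Nat.le_succ n)
    have h2 : (m.factorial : ℝ) / ((n : ℝ) + 1) ^ (m + 1) ≤ m.factorial :=
      div_le_self (by positivity) (one_le_pow₀ (by linarith [(n.cast_nonneg : (0 : ℝ) ≤ n)]))
    exact mul_le_mul h1 h2 (by positivity) (by positivity)
  have key := hasSum_integral_of_summable_integral_norm hFi hs
  have hfact : (m.factorial : ℂ) ≠ 0 := by exact_mod_cast m.factorial_ne_zero
  have key2 := key.mul_left ((m.factorial : ℂ)⁻¹)
  have hterms : (fun n : ℕ => x ^ (n + 1) / ((n : ℂ) + 1) ^ (m + 1))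
      = fun n => ((m.factorial : ℂ))⁻¹ * ∫ u in Ioi (0 : ℝ), F n u := by
    funext n
    simp only [hF]
    rw [integral_const_mul, integral_complex_ofReal, hint n]
    push_cast
    field_simp
  have hval : polylog (m + 1) x
      = ((m.factorial : ℂ))⁻¹ * ∫ u in Ioi (0 : ℝ), ∑' n, F n u := by
    rw [polylog, Nat.add_sub_cancel, div_eq_inv_mul, mul_assoc, ← integral_const_mul]
    congr 1
    refine setIntegral_congr_fun measurableSet_Ioi (fun u hu => ?_)
    have hu' : (0 : ℝ) < u := hu
    have hlt : ‖x * Complex.exp (-(u : ℂ))‖ < 1 := by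
      rw [norm_mul, Complex.norm_exp]
      have : Real.exp (-(u : ℂ)).re ≤ 1 := by
        rw [Real.exp_le_one_iff]; simp [hu'.le]
      nlinarith [norm_nonneg x]
    have hg := (hasSum_geometric_of_norm_lt_one hlt).mul_left
      (x * (u : ℂ) ^ m * Complex.exp (-(u : ℂ)))
    have hE : Complex.exp (u : ℂ) ≠ 0 := Complex.exp_ne_zero _
    have hne : Complex.exp (u : ℂ) - x ≠ 0 := by
      intro h0
      have hxe : x = Complex.exp (u : ℂ) := (sub_eq_zero.mp h0).symm
      rw [hxe, ← Complex.exp_add] at hlt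
      simp at hlt
    have hterm : ∀ n : ℕ, x * (u : ℂ) ^ m * Complex.exp (-(u : ℂ)) *
        (x * Complex.exp (-(u : ℂ))) ^ n = F n u := by
      intro n
      simp only [hF]
      push_cast
      rw [mul_pow, ← Complex.exp_nat_mul]
      have : Complex.exp (-((n : ℂ) + 1) * u)
          = Complex.exp (-(u : ℂ)) * Complex.exp (n * -(u : ℂ)) := by
        rw [← Complex.exp_add]; ring_nf
      rw [this]
      ring
    simp_rw [hterm] at hg
    have e2 := hg.tsum_eq
    rw [e2, Complex.exp_neg]
    have hne' : 1 - x * (Complex.exp (u : ℂ))⁻¹ ≠ 0 := by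
      intro h0
      apply hne
      field_simp at h0
      simpa using h0
    field_simp
  rw [hterms, hval]
  exact key2

theorem polylog_differentiableOn (m : ℕ) :
    DifferentiableOn ℂ (polylog m) {x : ℂ | 1 - x ∈ Complex.slitPlane} := by
  intro x₀ hx₀
  refine DifferentiableAt.differentiableWithinAt ?_
  have hnz : ∀ t ∈ Icc (0 : ℝ) 1, 1 - x₀ * (t : ℂ) ≠ 0 := by
    intro t ht h0
    rcases ht.1.eq_or_lt with h | hpos
    · rw [← h] at h0; simp at h0
    have ht' : (t : ℂ) ≠ 0 := by exact_mod_cast hpos.ne'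
    have hx : x₀ = ((1 / t : ℝ) : ℂ) := by
      push_cast
      rw [eq_div_iff ht']
      exact (sub_eq_zero.mp h0).symm
    have h1 : (1 : ℝ) ≤ 1 / t := by rw [le_div_iff₀ hpos]; linarith [ht.2]
    rw [mem_ofPred_eq, hx, Complex.mem_slitPlane_iff] at hx₀
    rcases hx₀ with h | h
    · simp only [Complex.sub_re, Complex.one_re, Complex.ofReal_re] at h; linarith
    · simp only [Complex.sub_im, Complex.one_im, Complex.ofReal_im] at h; simp at h
  obtain ⟨t₀, ht₀, hmin⟩ := (isCompact_Icc (a := (0 : ℝ)) (b := 1)).exists_isMinOn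
    (nonempty_Icc.mpr zero_le_one)
    (f := fun t : ℝ => ‖1 - x₀ * (t : ℂ)‖) (by fun_prop)
  set δ : ℝ := ‖1 - x₀ * (t₀ : ℂ)‖ / 2 with hδ
  have hδpos : 0 < δ := by
    have := norm_pos_iff.mpr (hnz t₀ ht₀)
    positivity
  have hlow : ∀ x ∈ Metric.ball x₀ δ, ∀ t ∈ Icc (0 : ℝ) 1, δ ≤ ‖1 - x * (t : ℂ)‖ := by
    intro x hx t ht
    have h1 : 2 * δ ≤ ‖1 - x₀ * (t : ℂ)‖ := by
      have := hmin ht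
      simp only [mem_ofPred_eq] at this
      rw [hδ]; linarith
    have h2 : ‖(x - x₀) * (t : ℂ)‖ ≤ δ := by
      rw [norm_mul, Complex.norm_real, Real.norm_eq_abs, abs_of_nonneg ht.1]
      have h3 : ‖x - x₀‖ < δ := by rwa [Metric.mem_ball, dist_eq_norm] at hx
      nlinarith [norm_nonneg (x - x₀), ht.1, ht.2]
    have h4 : 1 - x₀ * (t : ℂ) = (1 - x * t) + (x - x₀) * t := by ring
    have h5 := norm_add_le (1 - x * (t : ℂ)) ((x - x₀) * t)
    rw [← h4] at h5
    linarith
  have hlow2 : ∀ x ∈ Metric.ball x₀ δ, ∀ u ∈ Ioi (0 : ℝ),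
      δ * Real.exp u ≤ ‖Complex.exp (u : ℂ) - x‖ := by
    intro x hx u hu
    have hu' : (0 : ℝ) < u := hu
    have h := hlow x hx (Real.exp (-u)) ⟨(Real.exp_pos _).le, by
      rw [Real.exp_le_one_iff]; linarith⟩
    have e : Complex.exp (u : ℂ) - x
        = Complex.exp (u : ℂ) * (1 - x * ((Real.exp (-u) : ℝ) : ℂ)) := by
      push_cast
      rw [Complex.exp_neg]
      have hE : Complex.exp (u : ℂ) ≠ 0 := Complex.exp_ne_zero _
      field_simp
    rw [e, norm_mul, Complex.norm_exp, Complex.ofReal_re, mul_comm]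
    exact mul_le_mul_of_nonneg_left h (Real.exp_pos _).le
  have hne : ∀ x ∈ Metric.ball x₀ δ, ∀ u ∈ Ioi (0 : ℝ), Complex.exp (u : ℂ) - x ≠ 0 := by
    intro x hx u hu h0
    have := hlow2 x hx u hu
    rw [h0, norm_zero] at this
    have : 0 < δ * Real.exp u := by positivity
    linarith
  set n := m - 1 with hn
  have hmeas : ∀ x : ℂ, Measurable fun u : ℝ => (u : ℂ) ^ n / (Complex.exp (u : ℂ) - x) := by
    intro x
    fun_prop
  have hball : Metric.ball x₀ δ ∈ nhds x₀ := Metric.ball_mem_nhds _ hδpos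
  have hmem : x₀ ∈ Metric.ball x₀ δ := Metric.mem_ball_self hδpos
  have hd := hasDerivAt_integral_of_dominated_loc_of_deriv_le
    (μ := volume.restrict (Ioi (0 : ℝ)))
    (F := fun (x : ℂ) (u : ℝ) => (u : ℂ) ^ n / (Complex.exp (u : ℂ) - x))
    (F' := fun (x : ℂ) (u : ℝ) => (u : ℂ) ^ n / (Complex.exp (u : ℂ) - x) ^ 2)
    (x₀ := x₀) (s := Metric.ball x₀ δ)
    (bound := fun u => (δ ^ 2)⁻¹ * (u ^ n * Real.exp (-u)))
    hball
    (Filter.Eventually.of_forall fun x => (hmeas x).aestronglyMeasurable)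
    (by
      refine Integrable.mono' ((integrableOn_pow_mul_exp_neg n).const_mul δ⁻¹)
        (hmeas x₀).aestronglyMeasurable ?_
      refine (ae_restrict_iff' measurableSet_Ioi).mpr (Filter.Eventually.of_forall fun u hu => ?_)
      have hu' : (0 : ℝ) < u := hu
      rw [norm_div, norm_pow, Complex.norm_real, Real.norm_eq_abs, abs_of_pos hu']
      have h := hlow2 x₀ hmem u hu
      calc u ^ n / ‖Complex.exp (u : ℂ) - x₀‖ ≤ u ^ n / (δ * Real.exp u) := by gcongr
        _ = δ⁻¹ * (u ^ n * Real.exp (-u)) := by rw [Real.exp_neg]; field_simp)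
    (by
      have : Measurable fun u : ℝ => (u : ℂ) ^ n / (Complex.exp (u : ℂ) - x₀) ^ 2 := by fun_prop
      exact this.aestronglyMeasurable)
    (by
      refine (ae_restrict_iff' measurableSet_Ioi).mpr
        (Filter.Eventually.of_forall fun u hu x hx => ?_)
      have hu' : (0 : ℝ) < u := hu
      rw [norm_div, norm_pow, norm_pow, Complex.norm_real, Real.norm_eq_abs, abs_of_pos hu']
      have h := hlow2 x hx u hu
      have hexp : Real.exp u ≤ Real.exp u ^ 2 := by
        nlinarith [Real.one_le_exp hu'.le]
      calc u ^ n / ‖Complex.exp (u : ℂ) - x‖ ^ 2 ≤ u ^ n / (δ * Real.exp u) ^ 2 := by gcongr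
        _ = u ^ n / (δ ^ 2 * Real.exp u ^ 2) := by rw [mul_pow]
        _ ≤ u ^ n / (δ ^ 2 * Real.exp u) := by gcongr
        _ = (δ ^ 2)⁻¹ * (u ^ n * Real.exp (-u)) := by rw [Real.exp_neg]; field_simp)
    ((integrableOn_pow_mul_exp_neg n).const_mul _)
    (by
      refine (ae_restrict_iff' measurableSet_Ioi).mpr
        (Filter.Eventually.of_forall fun u hu x hx => ?_)
      have h1 : HasDerivAt (fun x : ℂ => Complex.exp (u : ℂ) - x) (-1) x := by
        simpa using (hasDerivAt_id x).const_sub (Complex.exp (u : ℂ))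
      have h2 := (hasDerivAt_const x ((u : ℂ) ^ n)).div h1 (hne x hx u hu)
      have e : (0 * (Complex.exp (u : ℂ) - x) - (u : ℂ) ^ n * (-1)) / (Complex.exp (u : ℂ) - x) ^ 2
          = (u : ℂ) ^ n / (Complex.exp (u : ℂ) - x) ^ 2 := by ring
      rw [e] at h2
      exact h2)
  have : polylog m = fun x => x / (n.factorial : ℂ) *
      ∫ u in Ioi (0 : ℝ), (u : ℂ) ^ n / (Complex.exp (u : ℂ) - x) := rfl
  rw [this]
  exact (differentiableAt_id.div_const _).mul hd.2.differentiableAt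

/-! Write `x = 1 - e^{-2iz}`. Substituting `y = x e^{-u}`, so that `u = log (x / y)`, turns both
kinds of polylogarithm into integrals along the segment from `0` to `x`: `n! Li_{n+1}(x) = -∫ log
(x/y)^n d(log (1 - y))`, and, after one integration by parts, `2 (n+1)! S_{n+1,2}(x) = ∫ log
(x/y)^{n+1} d(log (1 - y)^2)`.

The segment may be replaced by the arc `y = 1 - e^{-2it}`, `0 ≤ t ≤ z`. There `log (1 - y) = -2it`,
and `log (x/y)` becomes `log (sin z) - log (sin t) - i (z - t) = -L - i (z - t)` with `L = log (sin
t / sin z)`. This gives `polylog_sineArc` and `nielsenS_two_sineArc`; the `S_{n+1,2}` integrand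
carries an additional factor `t`. The change of path, `sineArc_mul_rayDens`, is done without contour
integration: the functions `x * rayDens g n x` satisfy the iterated-integral recursion for `dx/x`,
so a binomial sum in them and in the logarithm telescopes to an antiderivative of the arc integrand.

Real and imaginary parts now have integrands polynomial in `L`, `t` and `z - t`. In weight five a
linear combination leaves `-L^4` or `-t^2 L^2` up to powers of `z - t`. In weight six it leaves
`-L^5` after removing `5 (z - t)^4 L`. The integral of `(z - t)^4 L` reduces to that of `(z - t)^4
log (2 sin t)`, which `im_polylog_six_exp` evaluates from `log (2 sin t) = -Re Li_1(e^{-2it})` by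
the same telescoping; its boundary values are `Im Li_6(e^{-2iz})`, `ζ(3)` and `ζ(5)`. -/

/-! ### The cut plane and bounds along rays from the origin. -/

/-- The plane cut along `[1, ∞)`. -/
def cutPlane : Set ℂ := {x : ℂ | 1 - x ∈ Complex.slitPlane}

theorem isOpen_cutPlane : IsOpen cutPlane :=
  Complex.isOpen_slitPlane.preimage (by fun_prop)

theorem smul_mem_cutPlane {x : ℂ} (hx : x ∈ cutPlane) {s : ℝ} (h0 : 0 ≤ s) (h1 : s ≤ 1) :
    x * (s : ℂ) ∈ cutPlane := by
  have h := Complex.starConvex_one_slitPlane hx (sub_nonneg.mpr h1) h0 (by ring)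
  have e : (1 - s) • (1 : ℂ) + s • (1 - x) = 1 - x * s := by
    simp only [Complex.real_smul]; push_cast; ring
  rwa [e] at h

theorem exp_neg_mem_Icc {u : ℝ} (hu : 0 ≤ u) : 0 ≤ Real.exp (-u) ∧ Real.exp (-u) ≤ 1 :=
  ⟨(Real.exp_pos _).le, by rw [Real.exp_le_one_iff]; linarith⟩

/-- A function continuous on the cut plane is bounded on the cone from `0` over a small ball. -/
theorem exists_bound_cone {g : ℂ → ℂ} (hg : ContinuousOn g cutPlane) {x₀ : ℂ}
    (hx₀ : x₀ ∈ cutPlane) :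
    ∃ ε > 0, ∃ M : ℝ, 0 ≤ M ∧ ∀ x ∈ Metric.ball x₀ ε, x ∈ cutPlane ∧
      ∀ s : ℝ, 0 ≤ s → s ≤ 1 → ‖g (x * s)‖ ≤ M := by
  obtain ⟨ε, hε, hsub⟩ := Metric.nhds_basis_closedBall.mem_iff.mp (isOpen_cutPlane.mem_nhds hx₀)
  have hK : IsCompact ((fun p : ℂ × ℝ => p.1 * (p.2 : ℂ)) ''
      (Metric.closedBall x₀ ε ×ˢ Icc (0 : ℝ) 1)) :=
    ((isCompact_closedBall x₀ ε).prod isCompact_Icc).image (by fun_prop)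
  have hKD : (fun p : ℂ × ℝ => p.1 * (p.2 : ℂ)) ''
      (Metric.closedBall x₀ ε ×ˢ Icc (0 : ℝ) 1) ⊆ cutPlane := by
    rintro _ ⟨⟨x, s⟩, ⟨hx, hs⟩, rfl⟩
    exact smul_mem_cutPlane (hsub hx) hs.1 hs.2
  obtain ⟨C, hC⟩ := hK.exists_bound_of_continuousOn (hg.mono hKD)
  refine ⟨ε, hε, max C 0, le_max_right _ _, fun x hx => ?_⟩
  have hx' := Metric.ball_subset_closedBall hx
  exact ⟨hsub hx', fun s h0 h1 => (hC _ ⟨(x, s), ⟨hx', h0, h1⟩, rfl⟩).trans (le_max_left _ _)⟩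

/-- A primitive vanishing at `0` satisfies a linear bound along a ray. -/
theorem norm_primitive_le {G g : ℂ → ℂ} (hG : ∀ y ∈ cutPlane, HasDerivAt G (g y) y)
    (hG0 : G 0 = 0) {x : ℂ} (hx : x ∈ cutPlane) {M : ℝ}
    (hM : ∀ s : ℝ, 0 ≤ s → s ≤ 1 → ‖g (x * s)‖ ≤ M) {s : ℝ} (h0 : 0 ≤ s) (h1 : s ≤ 1) :
    ‖G (x * s)‖ ≤ M * ‖x‖ * s := by
  have hseg : ∀ y ∈ segment ℝ (0 : ℂ) (x * s), ∃ r : ℝ, 0 ≤ r ∧ r ≤ 1 ∧ y = x * r := by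
    intro y hy
    rw [segment_eq_image] at hy
    obtain ⟨θ, hθ, rfl⟩ := hy
    refine ⟨θ * s, mul_nonneg hθ.1 h0, mul_le_one₀ hθ.2 h0 h1, ?_⟩
    simp only [smul_zero, zero_add, Complex.real_smul]
    push_cast; ring
  have h := Convex.norm_image_sub_le_of_norm_hasDerivWithin_le (𝕜 := ℂ) (f := G) (f' := g)
    (s := segment ℝ (0 : ℂ) (x * s)) (x := 0) (y := x * s) (C := M)
    (fun y hy => by
      obtain ⟨r, hr0, hr1, rfl⟩ := hseg y hy
      exact (hG _ (smul_mem_cutPlane hx hr0 hr1)).hasDerivWithinAt)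
    (fun y hy => by
      obtain ⟨r, hr0, hr1, rfl⟩ := hseg y hy
      exact hM r hr0 hr1)
    (convex_segment _ _) (left_mem_segment _ _ _) (right_mem_segment _ _ _)
  rw [hG0, sub_zero, sub_zero, norm_mul, Complex.norm_real, Real.norm_eq_abs, abs_of_nonneg h0] at h
  linarith

/-! ### Ray integrals and their recursion under differentiation. -/

/-- `∫₀^∞ uⁿ G(x e^{-u}) du`. -/
noncomputable def rayPrim (G : ℂ → ℂ) (n : ℕ) (x : ℂ) : ℂ :=
  ∫ u in Ioi (0 : ℝ), (u : ℂ) ^ n * G (x * (Real.exp (-u) : ℝ))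

/-- `∫₀^∞ uⁿ e^{-u} g(x e^{-u}) du`. -/
noncomputable def rayDens (g : ℂ → ℂ) (n : ℕ) (x : ℂ) : ℂ :=
  ∫ u in Ioi (0 : ℝ), (u : ℂ) ^ n * ((Real.exp (-u) : ℝ) * g (x * (Real.exp (-u) : ℝ)))

theorem continuousOn_comp_ray {g : ℂ → ℂ} (hg : ContinuousOn g cutPlane) {x : ℂ}
    (hx : x ∈ cutPlane) :
    ContinuousOn (fun u : ℝ => g (x * (Real.exp (-u) : ℝ))) (Ici 0) := by
  refine hg.comp (by fun_prop) fun u hu => ?_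
  have := exp_neg_mem_Icc (mem_Ici.mp hu)
  exact smul_mem_cutPlane hx this.1 this.2

theorem integrableOn_rayDens {g : ℂ → ℂ} (hg : ContinuousOn g cutPlane) (n : ℕ) {x : ℂ}
    (hx : x ∈ cutPlane) :
    IntegrableOn (fun u : ℝ => (u : ℂ) ^ n *
      ((Real.exp (-u) : ℝ) * g (x * (Real.exp (-u) : ℝ)))) (Ioi 0) := by
  obtain ⟨ε, hε, M, hM0, hM⟩ := exists_bound_cone hg hx
  obtain ⟨-, hM⟩ := hM x (Metric.mem_ball_self hε)
  have hc := (continuousOn_comp_ray hg hx).mono Ioi_subset_Ici_self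
  refine Integrable.mono' ((integrableOn_pow_mul_exp_neg n).const_mul M)
    (((show Continuous fun u : ℝ => (u : ℂ) ^ n by fun_prop).continuousOn.mul
      ((show Continuous fun u : ℝ => ((Real.exp (-u) : ℝ) : ℂ) by fun_prop).continuousOn.mul
        hc)).aestronglyMeasurable measurableSet_Ioi) ?_
  refine (ae_restrict_iff' measurableSet_Ioi).mpr (Filter.Eventually.of_forall fun u hu => ?_)
  have hu' : (0 : ℝ) < u := hu
  have h := exp_neg_mem_Icc hu'.le
  have hb := hM _ h.1 h.2
  simp only [norm_mul, norm_pow, Complex.norm_real, Real.norm_eq_abs, abs_of_pos hu',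
    abs_of_nonneg h.1]
  calc u ^ n * (Real.exp (-u) * ‖g (x * (Real.exp (-u) : ℝ))‖)
      ≤ u ^ n * (Real.exp (-u) * M) := by gcongr
    _ = M * (u ^ n * Real.exp (-u)) := by ring

/-- There is no explicit factor `e^{-u}` here; the decay comes from `G 0 = 0`, which makes `G (x
e^{-u})` of size `O(e^{-u})`. -/
theorem integrableOn_rayPrim {G g : ℂ → ℂ} (hG : ∀ y ∈ cutPlane, HasDerivAt G (g y) y)
    (hg : ContinuousOn g cutPlane) (hG0 : G 0 = 0) (n : ℕ) {x : ℂ} (hx : x ∈ cutPlane) :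
    IntegrableOn (fun u : ℝ => (u : ℂ) ^ n * G (x * (Real.exp (-u) : ℝ))) (Ioi 0) := by
  obtain ⟨ε, hε, M, hM0, hM⟩ := exists_bound_cone hg hx
  obtain ⟨-, hM⟩ := hM x (Metric.mem_ball_self hε)
  have hGc : ContinuousOn G cutPlane := fun y hy => (hG y hy).continuousAt.continuousWithinAt
  have hc := (continuousOn_comp_ray hGc hx).mono Ioi_subset_Ici_self
  refine Integrable.mono' ((integrableOn_pow_mul_exp_neg n).const_mul (M * ‖x‖))
    (((show Continuous fun u : ℝ => (u : ℂ) ^ n by fun_prop).continuousOn.mul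
      hc).aestronglyMeasurable measurableSet_Ioi) ?_
  refine (ae_restrict_iff' measurableSet_Ioi).mpr (Filter.Eventually.of_forall fun u hu => ?_)
  have hu' : (0 : ℝ) < u := hu
  have h := exp_neg_mem_Icc hu'.le
  have hb := norm_primitive_le hG hG0 hx hM h.1 h.2
  simp only [norm_mul, norm_pow, Complex.norm_real, Real.norm_eq_abs, abs_of_pos hu']
  calc u ^ n * ‖G (x * (Real.exp (-u) : ℝ))‖ ≤ u ^ n * (M * ‖x‖ * Real.exp (-u)) := by gcongr
    _ = M * ‖x‖ * (u ^ n * Real.exp (-u)) := by ring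

/-- Differentiation under the integral sign. The bound for `g` on the cone over a small ball
dominates the derivative uniformly in `x`. -/
theorem hasDerivAt_rayPrim {G g : ℂ → ℂ} (hG : ∀ y ∈ cutPlane, HasDerivAt G (g y) y)
    (hg : ContinuousOn g cutPlane) (hG0 : G 0 = 0) (n : ℕ) {x₀ : ℂ} (hx₀ : x₀ ∈ cutPlane) :
    HasDerivAt (rayPrim G n) (rayDens g n x₀) x₀ := by
  obtain ⟨ε, hε, M, hM0, hM⟩ := exists_bound_cone hg hx₀
  have hball : Metric.ball x₀ ε ∈ nhds x₀ := Metric.ball_mem_nhds _ hε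
  refine (hasDerivAt_integral_of_dominated_loc_of_deriv_le
    (μ := volume.restrict (Ioi (0 : ℝ)))
    (F := fun (x : ℂ) (u : ℝ) => (u : ℂ) ^ n * G (x * (Real.exp (-u) : ℝ)))
    (F' := fun (x : ℂ) (u : ℝ) =>
      (u : ℂ) ^ n * ((Real.exp (-u) : ℝ) * g (x * (Real.exp (-u) : ℝ))))
    (bound := fun u => M * (u ^ n * Real.exp (-u)))
    hball ?_ (integrableOn_rayPrim hG hg hG0 n hx₀)
    (integrableOn_rayDens hg n hx₀).aestronglyMeasurable ?_
    ((integrableOn_pow_mul_exp_neg n).const_mul _) ?_).2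
  · filter_upwards [hball] with x hx
    exact (integrableOn_rayPrim hG hg hG0 n (hM x hx).1).aestronglyMeasurable
  · refine (ae_restrict_iff' measurableSet_Ioi).mpr
      (Filter.Eventually.of_forall fun u hu x hx => ?_)
    have hu' : (0 : ℝ) < u := hu
    have h := exp_neg_mem_Icc hu'.le
    have hb := (hM x hx).2 _ h.1 h.2
    simp only [norm_mul, norm_pow, Complex.norm_real, Real.norm_eq_abs, abs_of_pos hu',
      abs_of_nonneg h.1]
    calc u ^ n * (Real.exp (-u) * ‖g (x * (Real.exp (-u) : ℝ))‖)
        ≤ u ^ n * (Real.exp (-u) * M) := by gcongr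
      _ = M * (u ^ n * Real.exp (-u)) := by ring
  · refine (ae_restrict_iff' measurableSet_Ioi).mpr
      (Filter.Eventually.of_forall fun u hu x hx => ?_)
    have h := exp_neg_mem_Icc (le_of_lt (mem_Ioi.mp hu))
    have hd := hG _ (smul_mem_cutPlane (hM x hx).1 h.1 h.2)
    have h2 := (hd.comp x ((hasDerivAt_id x).mul_const ((Real.exp (-u) : ℝ) : ℂ))).const_mul
      ((u : ℂ) ^ n)
    refine h2.congr_deriv ?_
    ring

theorem hasDerivAt_comp_ray {G g : ℂ → ℂ} (hG : ∀ y ∈ cutPlane, HasDerivAt G (g y) y) {x : ℂ}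
    (hx : x ∈ cutPlane) {u : ℝ} (hu : 0 ≤ u) :
    HasDerivAt (fun u : ℝ => G (x * (Real.exp (-u) : ℝ)))
      (-(x * ((Real.exp (-u) : ℝ) * g (x * (Real.exp (-u) : ℝ))))) u := by
  have h := exp_neg_mem_Icc hu
  have hd := hG _ (smul_mem_cutPlane hx h.1 h.2)
  have h1 : HasDerivAt (fun u : ℝ => Real.exp (-u)) (-Real.exp (-u)) u := by
    simpa using (hasDerivAt_neg u).exp
  have h2 := hd.comp u (h1.ofReal_comp.const_mul x)
  refine h2.congr_deriv ?_
  push_cast; ring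

theorem tendsto_pow_mul_comp_ray {G g : ℂ → ℂ} (hG : ∀ y ∈ cutPlane, HasDerivAt G (g y) y)
    (hg : ContinuousOn g cutPlane) (hG0 : G 0 = 0) (n : ℕ) {x : ℂ} (hx : x ∈ cutPlane) :
    Filter.Tendsto (fun u : ℝ => (u : ℂ) ^ n * G (x * (Real.exp (-u) : ℝ))) Filter.atTop
      (nhds 0) := by
  obtain ⟨ε, hε, M, hM0, hM⟩ := exists_bound_cone hg hx
  obtain ⟨-, hM⟩ := hM x (Metric.mem_ball_self hε)
  have h0 := (Real.tendsto_pow_mul_exp_neg_atTop_nhds_zero n).const_mul (M * ‖x‖)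
  rw [mul_zero] at h0
  refine squeeze_zero_norm' ?_ h0
  filter_upwards [Filter.eventually_ge_atTop (0 : ℝ)] with u hu
  have h := exp_neg_mem_Icc hu
  have hb := norm_primitive_le hG hG0 hx hM h.1 h.2
  simp only [norm_mul, norm_pow, Complex.norm_real, Real.norm_eq_abs, abs_of_nonneg hu]
  calc u ^ n * ‖G (x * (Real.exp (-u) : ℝ))‖ ≤ u ^ n * (M * ‖x‖ * Real.exp (-u)) := by gcongr
    _ = M * ‖x‖ * (u ^ n * Real.exp (-u)) := by ring

/-- The fundamental theorem of calculus along the ray: the integrand is minus the `u`-derivative of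
`G (x e^{-u})`, which runs from `G x` to `G 0 = 0`. -/
theorem mul_rayDens_zero {G g : ℂ → ℂ} (hG : ∀ y ∈ cutPlane, HasDerivAt G (g y) y)
    (hg : ContinuousOn g cutPlane) (hG0 : G 0 = 0) {x : ℂ} (hx : x ∈ cutPlane) :
    x * rayDens g 0 x = G x := by
  have hi := (integrableOn_rayDens hg 0 hx).const_mul x
  have ht := tendsto_pow_mul_comp_ray hG hg hG0 0 hx
  simp only [pow_zero, one_mul] at hi ht
  have h := integral_Ioi_of_hasDerivAt_of_tendsto
    (hasDerivAt_comp_ray hG hx le_rfl).continuousAt.continuousWithinAt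
    (fun u hu => hasDerivAt_comp_ray hG hx (le_of_lt (mem_Ioi.mp hu))) hi.neg ht
  simp only [integral_neg, neg_zero, Real.exp_zero, Complex.ofReal_one, mul_one, zero_sub,
    neg_inj] at h
  rw [rayDens, ← integral_const_mul, ← h]
  simp

/-- Integration by parts in `u`. The boundary term `u^(n+1) G(x e^{-u})` vanishes at `0` because of
the power and at infinity because `G 0 = 0`. -/
theorem mul_rayDens_succ {G g : ℂ → ℂ} (hG : ∀ y ∈ cutPlane, HasDerivAt G (g y) y)
    (hg : ContinuousOn g cutPlane) (hG0 : G 0 = 0) (n : ℕ) {x : ℂ} (hx : x ∈ cutPlane) :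
    x * rayDens g (n + 1) x = (n + 1) * rayPrim G n x := by
  have hi := (integrableOn_rayDens hg (n + 1) hx).const_mul x
  have hj := (integrableOn_rayPrim hG hg hG0 n hx).const_mul ((n : ℂ) + 1)
  have hd : ∀ u : ℝ, 0 ≤ u → HasDerivAt
      (fun u : ℝ => (u : ℂ) ^ (n + 1) * G (x * (Real.exp (-u) : ℝ)))
      (((n : ℂ) + 1) * ((u : ℂ) ^ n * G (x * (Real.exp (-u) : ℝ)))
        - x * ((u : ℂ) ^ (n + 1) * ((Real.exp (-u) : ℝ) * g (x * (Real.exp (-u) : ℝ))))) u := by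
    intro u hu
    have h1 : HasDerivAt (fun u : ℝ => (u : ℂ) ^ (n + 1)) (((n : ℂ) + 1) * (u : ℂ) ^ n) u := by
      simpa using (hasDerivAt_id u).ofReal_comp.fun_pow (n + 1)
    refine (h1.mul (hasDerivAt_comp_ray hG hx hu)).congr_deriv ?_
    ring
  have h := integral_Ioi_of_hasDerivAt_of_tendsto
    (hd 0 le_rfl).continuousAt.continuousWithinAt (fun u hu => hd u (le_of_lt (mem_Ioi.mp hu)))
    (hj.sub hi) (tendsto_pow_mul_comp_ray hG hg hG0 (n + 1) hx)
  rw [integral_sub hj hi, integral_const_mul, integral_const_mul] at h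
  simp only [Complex.ofReal_zero, ne_eq, Nat.add_eq_zero_iff, one_ne_zero, and_false,
    not_false_eq_true, zero_pow, zero_mul, sub_zero] at h
  exact (sub_eq_zero.mp h).symm

/-- The recursion of iterated integrals against `dx/x`. Keeping the factor `x` outside `rayDens`
avoids dividing by `x`, so it also holds at the origin, where the arc starts. -/
theorem hasDerivAt_mul_rayDens_succ {G g : ℂ → ℂ} (hG : ∀ y ∈ cutPlane, HasDerivAt G (g y) y)
    (hg : ContinuousOn g cutPlane) (hG0 : G 0 = 0) (n : ℕ) {x : ℂ} (hx : x ∈ cutPlane) :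
    HasDerivAt (fun y => y * rayDens g (n + 1) y) ((n + 1) * rayDens g n x) x := by
  refine ((hasDerivAt_rayPrim hG hg hG0 n hx).const_mul ((n : ℂ) + 1)).congr_of_eventuallyEq ?_
  filter_upwards [isOpen_cutPlane.mem_nhds hx] with y hy
  exact mul_rayDens_succ hG hg hG0 n hy

theorem hasDerivAt_mul_rayDens_zero {G g : ℂ → ℂ} (hG : ∀ y ∈ cutPlane, HasDerivAt G (g y) y)
    (hg : ContinuousOn g cutPlane) (hG0 : G 0 = 0) {x : ℂ} (hx : x ∈ cutPlane) :
    HasDerivAt (fun y => y * rayDens g 0 y) (g x) x := by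
  refine (hG x hx).congr_of_eventuallyEq ?_
  filter_upwards [isOpen_cutPlane.mem_nhds hx] with y hy
  exact mul_rayDens_zero hG hg hG0 hy

/-! ### The telescoping sum and the arc. -/

/-- Telescoping derivative of a binomial sum. -/
theorem hasDerivAt_binomial_sum {v : ℝ → ℂ} {r : ℕ → ℝ → ℂ} {v' r' : ℂ} {t : ℝ}
    (hv : HasDerivAt v v' t) (h0 : HasDerivAt (r 0) r' t)
    (hs : ∀ j : ℕ, HasDerivAt (r (j + 1)) ((j + 1) * (-v') * r j t) t) (n : ℕ) :
    HasDerivAt (fun s => ∑ j ∈ Finset.range (n + 1), (n.choose j : ℂ) * (v s ^ (n - j) * r j s))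
      (v t ^ n * r') t := by
  set d : ℕ → ℂ := fun j => Nat.casesOn j r' fun i => ((i : ℂ) + 1) * (-v') * r i t with hd
  have hr : ∀ j, HasDerivAt (r j) (d j) t := fun j => by
    cases j with
    | zero => exact h0
    | succ i => exact hs i
  have h := HasDerivAt.fun_sum (u := Finset.range (n + 1)) fun j _ =>
    (((hv.fun_pow (n - j)).mul (hr j)).const_mul (n.choose j : ℂ))
  refine h.congr_deriv ?_
  simp_rw [mul_add]
  -- Split off the last term of the `v'` sum, whose factor `n - j` is zero, and the first term of
  -- the `r'` sum, which is the answer. The others cancel, term `j` of one against term `j + 1` of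
  -- the other.
  rw [Finset.sum_add_distrib, Finset.sum_range_succ, Finset.sum_range_succ' (fun j =>
    (n.choose j : ℂ) * (v t ^ (n - j) * d j)), add_add_add_comm, ← Finset.sum_add_distrib,
    Finset.sum_eq_zero]
  · simp [hd]
  · intro j hj
    have hj' : j < n := Finset.mem_range.mp hj
    have hc : (n.choose (j + 1) : ℂ) * (j + 1) = n.choose j * ((n - j : ℕ) : ℂ) := by
      exact_mod_cast Nat.choose_succ_right_eq n j
    have e : n - j - 1 = n - (j + 1) := by omega
    simp only [hd, e]
    linear_combination (-(v t ^ (n - (j + 1)) * v' * r j t)) * hc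

/-- The curve `1 - e^{-2it}`. -/
noncomputable def sineArc (t : ℝ) : ℂ := 1 - Complex.exp (-2 * Complex.I * t)

/-- Up to a constant, a logarithm of `sineArc`. -/
noncomputable def sineArcLog (t : ℝ) : ℂ := (Real.log (Real.sin t) : ℂ) - Complex.I * t

theorem exp_neg_two_I_mul_mem_slitPlane {t : ℝ} (h0 : 0 < t) (h1 : t < Real.pi / 2) :
    Complex.exp (-2 * Complex.I * t) ∈ Complex.slitPlane := by
  rw [Complex.mem_slitPlane_iff]
  right
  have e : (-2 * Complex.I * t : ℂ) = ((-(2 * t) : ℝ) : ℂ) * Complex.I := by push_cast; ring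
  rw [e, Complex.exp_ofReal_mul_I_im, Real.sin_neg]
  have := Real.sin_pos_of_pos_of_lt_pi (x := 2 * t) (by linarith) (by linarith)
  linarith

theorem sineArc_mem_cutPlane {t : ℝ} (h0 : 0 ≤ t) (h1 : t < Real.pi / 2) :
    sineArc t ∈ cutPlane := by
  have e : 1 - sineArc t = Complex.exp (-2 * Complex.I * t) := by simp [sineArc]
  rw [cutPlane, mem_ofPred_eq, e]
  rcases h0.eq_or_lt with rfl | h
  · simp
  · exact exp_neg_two_I_mul_mem_slitPlane h h1

theorem hasDerivAt_exp_neg_two_I_mul (t : ℝ) :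
    HasDerivAt (fun t : ℝ => Complex.exp (-2 * Complex.I * t))
      (-2 * Complex.I * Complex.exp (-2 * Complex.I * t)) t := by
  have h : HasDerivAt (fun t : ℝ => -2 * Complex.I * (t : ℂ)) (-2 * Complex.I) t := by
    simpa using (hasDerivAt_id t).ofReal_comp.const_mul (-2 * Complex.I)
  simpa [mul_comm] using h.cexp

theorem hasDerivAt_sineArc (t : ℝ) :
    HasDerivAt sineArc (2 * Complex.I * Complex.exp (-2 * Complex.I * t)) t := by
  refine ((hasDerivAt_exp_neg_two_I_mul t).const_sub 1).congr_deriv ?_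
  ring

theorem hasDerivAt_sineArcLog {t : ℝ} (h : Real.sin t ≠ 0) :
    HasDerivAt sineArcLog ((Real.cos t : ℂ) / Real.sin t - Complex.I) t := by
  have h1 := ((Real.hasDerivAt_sin t).log h).ofReal_comp
  have h2 : HasDerivAt (fun t : ℝ => Complex.I * (t : ℂ)) Complex.I t := by
    simpa using (hasDerivAt_id t).ofReal_comp.const_mul Complex.I
  refine (h1.sub h2).congr_deriv ?_
  push_cast; rfl

theorem exp_neg_two_I_mul_eq (t : ℝ) : Complex.exp (-2 * Complex.I * t)
    = (Complex.cos t - Complex.sin t * Complex.I) ^ 2 := by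
  have e : Complex.exp (-(t : ℂ) * Complex.I) = Complex.cos t - Complex.sin t * Complex.I := by
    rw [Complex.exp_mul_I, Complex.cos_neg, Complex.sin_neg]; ring
  rw [← e, ← Complex.exp_nat_mul]
  congr 1; push_cast; ring

/-- Since `sineArc t = 2i sin t e^{-it}`, the derivative of `sineArcLog` is the logarithmic
derivative of `sineArc`. This is what makes the recursion in `dx/x` match the powers of
`sineArcLog`. -/
theorem sineArc_mul_logDeriv {t : ℝ} (h : Real.sin t ≠ 0) :
    sineArc t * ((Real.cos t : ℂ) / Real.sin t - Complex.I)
      = 2 * Complex.I * Complex.exp (-2 * Complex.I * t) := by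
  have hs : (Real.sin t : ℂ) ≠ 0 := by exact_mod_cast h
  have h1 := Complex.sin_sq_add_cos_sq (t : ℂ)
  rw [sineArc, exp_neg_two_I_mul_eq]
  push_cast at hs ⊢
  field_simp
  linear_combination (-Complex.cos t + Complex.sin t * Complex.I) * h1 +
    (Complex.cos t * Complex.sin t ^ 2 - Complex.I * Complex.sin t ^ 3) * Complex.I_sq

/-! ### The logarithmic singularity at the start of the arc. -/

/-- Powers of `log (sin t)` are dominated by `t ^ (-1/2)`. -/
theorem exists_bound_log_sin_pow {K : ℝ} (hK : 0 ≤ K) (n : ℕ) : ∃ C : ℝ, 0 ≤ C ∧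
    ∀ t : ℝ, 0 < t → t ≤ Real.pi / 2 →
      (K + |Real.log (Real.sin t)|) ^ n ≤ C * t ^ (-(1 / 2) : ℝ) := by
  -- Chosen so that `ε * n ≤ 1/2`: one logarithm costs `s ^ (-ε)`, hence `n` of them cost at most `s
  -- ^ (-1/2)`.
  set ε : ℝ := 1 / (2 * (n + 1)) with hε
  have hεpos : 0 < ε := by positivity
  refine ⟨(K + 1 / ε) ^ n * (2 / Real.pi) ^ (-(1 / 2) : ℝ), by positivity, fun t h0 h1 => ?_⟩
  set s : ℝ := 2 / Real.pi * t with hs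
  have hs0 : 0 < s := by positivity
  have hsin : s ≤ Real.sin t := Real.mul_le_sin h0.le h1
  have hs1 : s ≤ 1 := hsin.trans (Real.sin_le_one t)
  have hlog : |Real.log (Real.sin t)| ≤ |Real.log s| := by
    rw [abs_of_nonpos (Real.log_nonpos (hs0.le.trans hsin) (Real.sin_le_one t)),
      abs_of_nonpos (Real.log_nonpos hs0.le hs1)]
    exact neg_le_neg (Real.log_le_log hs0 hsin)
  have hp : 0 < s ^ ε := Real.rpow_pos_of_pos hs0 _
  have hb : |Real.log s| ≤ 1 / ε * s ^ (-ε) := by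
    have h := (Real.abs_log_mul_self_rpow_lt s ε hs0 hs1 hεpos).le
    rw [abs_mul, abs_of_pos hp] at h
    rw [Real.rpow_neg hs0.le, ← div_eq_mul_inv, le_div_iff₀ hp]
    exact h
  have hone : 1 ≤ s ^ (-ε) := Real.one_le_rpow_of_pos_of_le_one_of_nonpos hs0 hs1 (by linarith)
  have hA : K + |Real.log (Real.sin t)| ≤ (K + 1 / ε) * s ^ (-ε) := by
    rw [add_mul]
    exact add_le_add (le_mul_of_one_le_right hK hone) (hlog.trans hb)
  calc (K + |Real.log (Real.sin t)|) ^ n ≤ ((K + 1 / ε) * s ^ (-ε)) ^ n := by gcongr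
    _ = (K + 1 / ε) ^ n * s ^ (-ε * n) := by
        rw [mul_pow, ← Real.rpow_natCast (s ^ (-ε)), ← Real.rpow_mul hs0.le]
    _ ≤ (K + 1 / ε) ^ n * s ^ (-(1 / 2) : ℝ) := by
        refine mul_le_mul_of_nonneg_left ?_ (by positivity)
        refine Real.rpow_le_rpow_of_exponent_ge hs0 hs1 ?_
        have : ε * n ≤ 1 / 2 := by
          rw [hε, div_mul_eq_mul_div, one_mul, div_le_div_iff₀ (by positivity) (by norm_num)]
          linarith
        linarith
    _ = (K + 1 / ε) ^ n * (2 / Real.pi) ^ (-(1 / 2) : ℝ) * t ^ (-(1 / 2) : ℝ) := by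
        rw [hs, Real.mul_rpow (by positivity) h0.le, mul_assoc]

/-- A function continuous on `(0, z]` and dominated by a multiple of `t ^ (-1/2)` is integrable. -/
theorem intervalIntegrable_of_le_rpow {E : Type*} [NormedAddCommGroup E] {f : ℝ → E} {z C : ℝ}
    (hz : 0 ≤ z) (hf : ContinuousOn f (Ioc 0 z))
    (hb : ∀ t ∈ Ioc 0 z, ‖f t‖ ≤ C * t ^ (-(1 / 2) : ℝ)) : IntervalIntegrable f volume 0 z := by
  have h := (intervalIntegral.intervalIntegrable_rpow' (a := 0) (b := z)
    (r := (-(1 / 2) : ℝ)) (by norm_num)).const_mul C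
  rw [intervalIntegrable_iff_integrableOn_Ioc_of_le hz] at h ⊢
  exact Integrable.mono' h (hf.aestronglyMeasurable measurableSet_Ioc)
    ((ae_restrict_iff' measurableSet_Ioc).mpr (Filter.Eventually.of_forall hb))

theorem norm_sineArcLog_sub_le {z t : ℝ} (hz : z < Real.pi / 2) (h0 : 0 < t) (h1 : t ≤ z) :
    ‖sineArcLog z - sineArcLog t‖
      ≤ (|Real.log (Real.sin z)| + Real.pi) + |Real.log (Real.sin t)| := by
  have e : sineArcLog z - sineArcLog t = (Real.log (Real.sin z) : ℂ)
      - (Real.log (Real.sin t) : ℂ) - Complex.I * ((z - t : ℝ) : ℂ) := by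
    simp only [sineArcLog]; push_cast; ring
  rw [e]
  refine (norm_sub_le _ _).trans ?_
  have h2 := norm_sub_le (Real.log (Real.sin z) : ℂ) (Real.log (Real.sin t) : ℂ)
  have h3 : ‖Complex.I * ((z - t : ℝ) : ℂ)‖ ≤ Real.pi := by
    rw [norm_mul, Complex.norm_I, one_mul, Complex.norm_real, Real.norm_eq_abs,
      abs_of_nonneg (by linarith)]
    linarith [Real.pi_pos]
  rw [Complex.norm_real, Complex.norm_real, Real.norm_eq_abs, Real.norm_eq_abs] at h2
  linarith

theorem exists_bound_sineArcLog_pow {z : ℝ} (hz : z < Real.pi / 2) (n : ℕ) :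
    ∃ C : ℝ, 0 ≤ C ∧ ∀ t ∈ Ioc 0 z,
      ‖(sineArcLog z - sineArcLog t) ^ n‖ ≤ C * t ^ (-(1 / 2) : ℝ) := by
  obtain ⟨C, hC, hb⟩ := exists_bound_log_sin_pow
    (K := |Real.log (Real.sin z)| + Real.pi) (by positivity) n
  refine ⟨C, hC, fun t ht => le_trans ?_ (hb t ht.1 (ht.2.trans hz.le))⟩
  rw [norm_pow]
  exact pow_le_pow_left₀ (norm_nonneg _) (norm_sineArcLog_sub_le hz ht.1 ht.2) n

theorem sin_ne_zero_of_mem {t : ℝ} (h0 : 0 < t) (h1 : t < Real.pi / 2) : Real.sin t ≠ 0 :=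
  (Real.sin_pos_of_pos_of_lt_pi h0 (by linarith [Real.pi_pos])).ne'

theorem intervalIntegrable_sineArcLog_pow_mul {z : ℝ} (h0 : 0 ≤ z) (hz : z < Real.pi / 2) (n : ℕ)
    {φ : ℝ → ℂ} (hφ : ContinuousOn φ (Icc 0 z)) :
    IntervalIntegrable (fun t => (sineArcLog z - sineArcLog t) ^ n * φ t) volume 0 z := by
  obtain ⟨C, hC, hb⟩ := exists_bound_sineArcLog_pow hz n
  obtain ⟨B, hB⟩ := isCompact_Icc.exists_bound_of_continuousOn hφ
  refine intervalIntegrable_of_le_rpow (C := C * B) h0 ?_ fun t ht => ?_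
  · refine ContinuousOn.mul (ContinuousOn.pow (continuousOn_const.sub fun t ht => ?_) n)
      (hφ.mono Ioc_subset_Icc_self)
    exact (hasDerivAt_sineArcLog
      (sin_ne_zero_of_mem ht.1 (ht.2.trans_lt hz))).continuousAt.continuousWithinAt
  · rw [norm_mul]
    calc _ ≤ (C * t ^ (-(1 / 2) : ℝ)) * B :=
          mul_le_mul (hb t ht) (hB t (Ioc_subset_Icc_self ht)) (norm_nonneg _)
            ((norm_nonneg _).trans (hb t ht))
      _ = _ := by ring

/-- A function that is `O(t)` at `0` kills every power of the logarithm. -/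
theorem tendsto_sineArcLog_pow_mul {z : ℝ} (h0 : 0 < z) (hz : z < Real.pi / 2) (n : ℕ)
    {r : ℝ → ℂ} {r' : ℂ} (hr : HasDerivAt r r' 0) (hr0 : r 0 = 0) :
    Filter.Tendsto (fun t => (sineArcLog z - sineArcLog t) ^ n * r t) (nhdsWithin 0 (Ioi 0))
      (nhds 0) := by
  obtain ⟨C, hC, hb⟩ := exists_bound_sineArcLog_pow hz n
  obtain ⟨B, hB⟩ := hr.isBigO_sub.bound
  have hlim : Filter.Tendsto (fun t : ℝ => C * B * t ^ (1 / 2 : ℝ)) (nhdsWithin 0 (Ioi 0))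
      (nhds 0) := by
    have h := ((Real.continuous_rpow_const (q := 1 / 2) (by norm_num)).tendsto (0 : ℝ)).const_mul
      (C * B)
    rw [Real.zero_rpow (by norm_num), mul_zero] at h
    exact h.mono_left nhdsWithin_le_nhds
  refine squeeze_zero_norm' ?_ hlim
  filter_upwards [nhdsWithin_le_nhds hB, Ioc_mem_nhdsGT h0] with t ht1 ht2
  rw [hr0, sub_zero, sub_zero, Real.norm_eq_abs, abs_of_pos ht2.1] at ht1
  rw [norm_mul]
  have e : t ^ (1 / 2 : ℝ) = t ^ (-(1 / 2) : ℝ) * t := by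
    rw [← Real.rpow_add_one ht2.1.ne']; norm_num
  calc _ ≤ (C * t ^ (-(1 / 2) : ℝ)) * (B * t) :=
        mul_le_mul (hb t ht2) ht1 (norm_nonneg _) ((norm_nonneg _).trans (hb t ht2))
    _ = _ := by rw [e]; ring

/-! ### Exchanging the ray for the arc. -/

/-- The ray integral at the end point of the arc equals an integral along the arc. -/
theorem sineArc_mul_rayDens {G g : ℂ → ℂ} (hG : ∀ y ∈ cutPlane, HasDerivAt G (g y) y)
    (hg : ContinuousOn g cutPlane) (hG0 : G 0 = 0) (n : ℕ) {z : ℝ} (h0 : 0 < z)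
    (hz : z < Real.pi / 2) :
    sineArc z * rayDens g n (sineArc z) = ∫ t in (0 : ℝ)..z, (sineArcLog z - sineArcLog t) ^ n *
      (g (sineArc t) * (2 * Complex.I * Complex.exp (-2 * Complex.I * t))) := by
  set r : ℕ → ℝ → ℂ := fun j t => sineArc t * rayDens g j (sineArc t) with hr
  have hmem : ∀ t ∈ Icc 0 z, sineArc t ∈ cutPlane := fun t ht =>
    sineArc_mem_cutPlane ht.1 (ht.2.trans_lt hz)
  have hr0 : ∀ t ∈ Icc 0 z, HasDerivAt (r 0)
      (g (sineArc t) * (2 * Complex.I * Complex.exp (-2 * Complex.I * t))) t := fun t ht =>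
    (hasDerivAt_mul_rayDens_zero hG hg hG0 (hmem t ht)).comp t (hasDerivAt_sineArc t)
  have hrs : ∀ j : ℕ, ∀ t ∈ Icc 0 z, HasDerivAt (r (j + 1))
      ((j + 1) * rayDens g j (sineArc t) *
        (2 * Complex.I * Complex.exp (-2 * Complex.I * t))) t := fun j t ht =>
    (hasDerivAt_mul_rayDens_succ hG hg hG0 j (hmem t ht)).comp t (hasDerivAt_sineArc t)
  have hrd : ∀ j : ℕ, ∀ t ∈ Icc 0 z, ∃ r', HasDerivAt (r j) r' t := fun j t ht => by
    cases j with
    | zero => exact ⟨_, hr0 t ht⟩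
    | succ i => exact ⟨_, hrs i t ht⟩
  have hz0 : (0 : ℝ) ∈ Icc 0 z := ⟨le_rfl, h0.le⟩
  set P : ℝ → ℂ := fun s => ∑ j ∈ Finset.range (n + 1),
    (n.choose j : ℂ) * ((sineArcLog z - sineArcLog s) ^ (n - j) * r j s) with hP
  have hd : ∀ t ∈ Ioc 0 z, HasDerivAt P ((sineArcLog z - sineArcLog t) ^ n *
      (g (sineArc t) * (2 * Complex.I * Complex.exp (-2 * Complex.I * t)))) t := by
    intro t ht
    have hsin := sin_ne_zero_of_mem ht.1 (ht.2.trans_lt hz)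
    refine hasDerivAt_binomial_sum ((hasDerivAt_sineArcLog hsin).const_sub (sineArcLog z))
      (hr0 t (Ioc_subset_Icc_self ht)) (fun j => ?_) n
    refine (hrs j t (Ioc_subset_Icc_self ht)).congr_deriv ?_
    rw [← sineArc_mul_logDeriv hsin]
    simp only [hr]; ring
  have hi : IntervalIntegrable (fun t => (sineArcLog z - sineArcLog t) ^ n *
      (g (sineArc t) * (2 * Complex.I * Complex.exp (-2 * Complex.I * t)))) volume 0 z := by
    refine intervalIntegrable_sineArcLog_pow_mul h0.le hz n (ContinuousOn.mul ?_ (by fun_prop))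
    exact hg.comp (fun t _ => (hasDerivAt_sineArc t).continuousAt.continuousWithinAt) hmem
  -- Only a one-sided limit is available, as `sineArcLog` is singular at `0`. Each `r j` is
  -- differentiable there and vanishes, so it is `O(t)` and beats the logarithms.
  have hl : Filter.Tendsto P (nhdsWithin 0 (Ioi 0)) (nhds 0) := by
    have h := tendsto_finsetSum (Finset.range (n + 1)) fun j _ => by
      obtain ⟨r', hr'⟩ := hrd j 0 hz0
      exact (tendsto_sineArcLog_pow_mul h0 hz (n - j) hr' (by simp [hr, sineArc])).const_mul
        (n.choose j : ℂ)
    simpa using h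
  have hzr : Filter.Tendsto P (nhdsWithin z (Iio z)) (nhds (P z)) :=
    (hd z ⟨h0, le_rfl⟩).continuousAt.tendsto.mono_left nhdsWithin_le_nhds
  rw [intervalIntegral.integral_eq_sub_of_hasDerivAt_of_tendsto h0
    (fun t ht => hd t (Ioo_subset_Ioc_self ht)) hi hl hzr, sub_zero]
  simp only [hP, hr]
  -- At the end point the logarithmic difference is zero, so only `j = n` survives.
  rw [Finset.sum_range_succ, Finset.sum_eq_zero]
  · simp
  · intro j hj
    have : n - j ≠ 0 := by have := Finset.mem_range.mp hj; omega
    simp [this]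

/-! ### Polylogarithms as ray integrals, then as arc integrals. -/

theorem one_sub_ne_zero_of_mem_cutPlane {y : ℂ} (hy : y ∈ cutPlane) : 1 - y ≠ 0 :=
  Complex.slitPlane_ne_zero hy

/-- The derivative of `log (1 - y) ^ k`. -/
noncomputable def logPowDeriv (k : ℕ) (y : ℂ) : ℂ :=
  k * Complex.log (1 - y) ^ (k - 1) * -(1 - y)⁻¹

theorem hasDerivAt_log_one_sub_pow (k : ℕ) {y : ℂ} (hy : y ∈ cutPlane) :
    HasDerivAt (fun y => Complex.log (1 - y) ^ k) (logPowDeriv k y) y := by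
  have h := (((hasDerivAt_id y).const_sub 1).clog hy).fun_pow k
  refine h.congr_deriv ?_
  simp only [logPowDeriv, id, neg_div, one_div]

theorem continuousOn_logPowDeriv (k : ℕ) : ContinuousOn (logPowDeriv k) cutPlane := by
  have h1 : ContinuousOn (fun y : ℂ => 1 - y) cutPlane := by fun_prop
  exact (continuousOn_const.mul ((h1.clog fun y hy => hy).pow _)).mul
    (h1.inv₀ fun y hy => one_sub_ne_zero_of_mem_cutPlane hy).neg

/-- On the arc `1 - y = e^{-2it}` with `|2t| < π`, so the principal logarithm is exactly `-2it`, and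
`(1 - y)⁻¹` cancels the exponential in the velocity. -/
theorem logPowDeriv_sineArc (k : ℕ) {t : ℝ} (h0 : 0 ≤ t) (h1 : t < Real.pi / 2) :
    logPowDeriv k (sineArc t) * (2 * Complex.I * Complex.exp (-2 * Complex.I * t))
      = -(2 * Complex.I * k * (-2 * Complex.I * t) ^ (k - 1)) := by
  have e : 1 - sineArc t = Complex.exp (-2 * Complex.I * t) := by simp [sineArc]
  have hl : Complex.log (Complex.exp (-2 * Complex.I * t)) = -2 * Complex.I * t := by
    refine Complex.log_exp ?_ ?_ <;> simp <;> linarith [Real.pi_pos]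
  have hne := Complex.exp_ne_zero (-2 * Complex.I * t)
  rw [logPowDeriv, e, hl]
  field_simp

theorem polylog_succ_eq_rayDens (n : ℕ) {x : ℂ} (hx : x ∈ cutPlane) :
    polylog (n + 1) x = -(x * rayDens (logPowDeriv 1) n x) / n.factorial := by
  have h : ∫ u in Ioi (0 : ℝ), (u : ℂ) ^ n / (Complex.exp (u : ℂ) - x)
      = -rayDens (logPowDeriv 1) n x := by
    rw [rayDens, ← integral_neg]
    refine setIntegral_congr_fun measurableSet_Ioi fun u hu => ?_
    have hu' := exp_neg_mem_Icc (le_of_lt (mem_Ioi.mp hu))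
    have hne := one_sub_ne_zero_of_mem_cutPlane (smul_mem_cutPlane hx hu'.1 hu'.2)
    have hE : Complex.exp (u : ℂ) ≠ 0 := Complex.exp_ne_zero _
    have e : Complex.exp (u : ℂ) - x
        = Complex.exp (u : ℂ) * (1 - x * ((Real.exp (-u) : ℝ) : ℂ)) := by
      push_cast
      rw [Complex.exp_neg]
      field_simp
    simp only [logPowDeriv]
    rw [e]
    push_cast
    rw [Complex.exp_neg]
    simp [div_eq_mul_inv, mul_comm]
  rw [polylog, Nat.add_sub_cancel, h]
  ring

theorem hasDerivAt_polylog_add_two (n : ℕ) {x : ℂ} (hx : x ∈ cutPlane) (hx0 : x ≠ 0) :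
    HasDerivAt (polylog (n + 2)) (polylog (n + 1) x / x) x := by
  have h := ((hasDerivAt_mul_rayDens_succ (fun y hy => hasDerivAt_log_one_sub_pow 1 hy)
    (continuousOn_logPowDeriv 1) (by simp) n hx).neg.div_const ((n + 1).factorial : ℂ))
  refine (h.congr_of_eventuallyEq ?_).congr_deriv ?_
  · filter_upwards [isOpen_cutPlane.mem_nhds hx] with y hy
    exact polylog_succ_eq_rayDens (n + 1) hy
  · rw [polylog_succ_eq_rayDens n hx, Nat.factorial_succ]
    have h1 : ((n : ℂ) + 1) ≠ 0 := by exact_mod_cast n.succ_ne_zero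
    have h2 : (n.factorial : ℂ) ≠ 0 := by exact_mod_cast n.factorial_ne_zero
    push_cast
    field_simp

theorem polylog_one {x : ℂ} (hx : x ∈ cutPlane) : polylog 1 x = -Complex.log (1 - x) := by
  have h := polylog_succ_eq_rayDens 0 hx
  rw [mul_rayDens_zero (fun y hy => hasDerivAt_log_one_sub_pow 1 hy)
    (continuousOn_logPowDeriv 1) (by simp) hx] at h
  simpa using h

/-- The substitution `t = e^{-u}`. The change of variables formula for an injective map needs no
integrability, so `f` is arbitrary. -/
theorem integral_unit_interval_eq_exp_neg (f : ℝ → ℂ) :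
    ∫ t in (0 : ℝ)..1, f t = ∫ u in Ioi (0 : ℝ), (Real.exp (-u) : ℂ) * f (Real.exp (-u)) := by
  have himg : (fun u : ℝ => Real.exp (-u)) '' Ioi 0 = Ioo 0 1 := by
    ext t
    constructor
    · rintro ⟨u, hu, rfl⟩
      exact ⟨Real.exp_pos _, by
        have : (0 : ℝ) < u := hu
        rw [Real.exp_lt_one_iff]; linarith⟩
    · rintro ⟨h0, h1⟩
      exact ⟨-Real.log t, by simpa using Real.log_neg h0 h1, by simp [Real.exp_log h0]⟩
  have hd : ∀ u ∈ Ioi (0 : ℝ), HasDerivWithinAt (fun u : ℝ => Real.exp (-u)) (-Real.exp (-u))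
      (Ioi 0) u := fun u _ => by
    simpa using (hasDerivAt_neg u).exp.hasDerivWithinAt
  have hinj : InjOn (fun u : ℝ => Real.exp (-u)) (Ioi 0) := fun a _ b _ h => by
    simpa using h
  rw [intervalIntegral.integral_of_le zero_le_one, integral_Ioc_eq_integral_Ioo, ← himg,
    integral_image_eq_integral_abs_deriv_smul measurableSet_Ioi hd hinj]
  refine setIntegral_congr_fun measurableSet_Ioi fun u _ => ?_
  simp [abs_of_pos (Real.exp_pos _)]

theorem nielsenS_succ_eq_rayPrim (n k : ℕ) (x : ℂ) :
    nielsenS (n + 1) k x = (-1) ^ k / (n.factorial * k.factorial) *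
      rayPrim (fun y => Complex.log (1 - y) ^ k) n x := by
  rw [nielsenS, integral_unit_interval_eq_exp_neg, rayPrim]
  have h : ∀ u : ℝ, (Real.exp (-u) : ℂ) * ((Real.log (Real.exp (-u)) : ℂ) ^ (n + 1 - 1) *
      Complex.log (1 - x * (Real.exp (-u) : ℝ)) ^ k / (Real.exp (-u) : ℝ))
      = (-1) ^ n * ((u : ℂ) ^ n * Complex.log (1 - x * (Real.exp (-u) : ℝ)) ^ k) := by
    intro u
    have hE : ((Real.exp (-u) : ℝ) : ℂ) ≠ 0 := by exact_mod_cast (Real.exp_pos _).ne'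
    rw [Real.log_exp, Nat.add_sub_cancel, Complex.ofReal_neg, neg_pow]
    field_simp
  simp_rw [h]
  have h2 : ((-1 : ℂ)) ^ (n + 1 + k - 1) * (-1) ^ n = (-1) ^ k := by
    rw [show n + 1 + k - 1 = n + k by omega, pow_add, mul_right_comm, ← mul_pow]
    simp
  rw [integral_const_mul, ← h2, Nat.add_sub_cancel]
  ring

theorem sineArc_mul_rayDens_logPowDeriv (k n : ℕ) (hk : k ≠ 0) {z : ℝ} (h0 : 0 < z)
    (hz : z < Real.pi / 2) :
    sineArc z * rayDens (logPowDeriv k) n (sineArc z)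
      = -(2 * Complex.I * k * (-2 * Complex.I) ^ (k - 1)) *
        ∫ t in (0 : ℝ)..z, (sineArcLog z - sineArcLog t) ^ n * (t : ℂ) ^ (k - 1) := by
  rw [sineArc_mul_rayDens (fun y hy => hasDerivAt_log_one_sub_pow k hy)
    (continuousOn_logPowDeriv k) (by simp [hk]) n h0 hz, ← intervalIntegral.integral_const_mul]
  refine intervalIntegral.integral_congr fun t ht => ?_
  rw [uIcc_of_le h0.le] at ht
  simp only [logPowDeriv_sineArc k ht.1 (ht.2.trans_lt hz), mul_pow]
  ring

/-- `Li_{n+1}` on the arc `1 - e^{-2iz}` as a complex log-sine integral. -/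
theorem polylog_sineArc (n : ℕ) {z : ℝ} (h0 : 0 < z) (hz : z < Real.pi / 2) :
    polylog (n + 1) (sineArc z) = 2 * Complex.I / n.factorial *
      ∫ t in (0 : ℝ)..z, (sineArcLog z - sineArcLog t) ^ n := by
  rw [polylog_succ_eq_rayDens n (sineArc_mem_cutPlane h0.le hz),
    sineArc_mul_rayDens_logPowDeriv 1 n one_ne_zero h0 hz]
  simp
  ring

/-- `S_{n+1,2}` on the arc `1 - e^{-2iz}` as a complex log-sine integral. -/
theorem nielsenS_two_sineArc (n : ℕ) {z : ℝ} (h0 : 0 < z) (hz : z < Real.pi / 2) :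
    nielsenS (n + 1) 2 (sineArc z) = -4 / (n + 1).factorial *
      ∫ t in (0 : ℝ)..z, (sineArcLog z - sineArcLog t) ^ (n + 1) * t := by
  -- Integration by parts trades the primitive at level `n` for the density at level `n + 1`; this
  -- is why the exponent in the arc integral is `n + 1`.
  have h := mul_rayDens_succ (fun y hy => hasDerivAt_log_one_sub_pow 2 hy)
    (continuousOn_logPowDeriv 2) (by simp) n (sineArc_mem_cutPlane h0.le hz)
  rw [sineArc_mul_rayDens_logPowDeriv 2 (n + 1) two_ne_zero h0 hz] at h
  have h1 : ((n : ℂ) + 1) ≠ 0 := by exact_mod_cast n.succ_ne_zero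
  have h2 : (n.factorial : ℂ) ≠ 0 := by exact_mod_cast n.factorial_ne_zero
  have h3 : rayPrim (fun y => Complex.log (1 - y) ^ 2) n (sineArc z) = -8 / (n + 1) *
      ∫ t in (0 : ℝ)..z, (sineArcLog z - sineArcLog t) ^ (n + 1) * t := by
    rw [div_mul_eq_mul_div, eq_div_iff h1, mul_comm, ← h]
    simp only [Nat.add_one_sub_one, pow_one, Nat.cast_ofNat]
    linear_combination (8 * ∫ t in (0 : ℝ)..z,
      (sineArcLog z - sineArcLog t) ^ (n + 1) * (t : ℂ)) * Complex.I_sq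
  rw [nielsenS_succ_eq_rayPrim, h3, Nat.factorial_succ n, Nat.factorial_two]
  push_cast
  field_simp
  ring

/-! ### Polylogarithms on the unit circle and zeta values. -/

theorem exp_neg_two_I_mul_mem_cutPlane {t : ℝ} (h0 : 0 < t) (h1 : t < Real.pi / 2) :
    Complex.exp (-2 * Complex.I * t) ∈ cutPlane := by
  rw [cutPlane, mem_ofPred_eq, Complex.mem_slitPlane_iff]
  right
  have h := exp_neg_two_I_mul_eq t
  have e : (1 - Complex.exp (-2 * Complex.I * t)).im = 2 * Real.sin t * Real.cos t := by
    have e1 : (Complex.cos t - Complex.sin t * Complex.I)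
        = ((Real.cos t : ℝ) : ℂ) - ((Real.sin t : ℝ) : ℂ) * Complex.I := by push_cast; rfl
    rw [h, e1]
    simp [pow_two, -Complex.ofReal_cos, -Complex.ofReal_sin]; ring
  rw [e]
  have hs := sin_ne_zero_of_mem h0 h1
  have hc : Real.cos t ≠ 0 := (Real.cos_pos_of_mem_Ioo ⟨by linarith, h1⟩).ne'
  positivity

theorem norm_sineArc (t : ℝ) : ‖sineArc t‖ = 2 * |Real.sin t| := by
  have e : sineArc t = 2 * (Real.sin t : ℂ) * (Complex.I * Complex.exp ((-t : ℝ) * Complex.I)) := by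
    have h1 := Complex.sin_sq_add_cos_sq (t : ℂ)
    rw [sineArc, exp_neg_two_I_mul_eq, Complex.exp_mul_I]
    push_cast
    rw [Complex.cos_neg, Complex.sin_neg]
    linear_combination -h1 + Complex.sin (t : ℂ) ^ 2 * Complex.I_sq
  rw [e, norm_mul, norm_mul, norm_mul, Complex.norm_I, Complex.norm_exp_ofReal_mul_I]
  simp [-Complex.ofReal_sin]

theorem summable_one_div_succ_pow {m : ℕ} (hm : 2 ≤ m) :
    Summable fun n : ℕ => 1 / ((n : ℝ) + 1) ^ m := by
  have h := (summable_nat_add_iff 1).mpr (Real.summable_one_div_nat_pow.mpr (show 1 < m by omega))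
  simpa using h

theorem continuousOn_polylog_series {m : ℕ} (hm : 2 ≤ m) :
    ContinuousOn (fun x : ℂ => ∑' n : ℕ, x ^ (n + 1) / ((n : ℂ) + 1) ^ m)
      (Metric.closedBall 0 1) := by
  refine continuousOn_tsum (fun n => by fun_prop) (summable_one_div_succ_pow hm) fun n x hx => ?_
  have hx' : ‖x‖ ≤ 1 := by simpa using hx
  have hn : ‖((n : ℂ) + 1)‖ = (n : ℝ) + 1 := by exact_mod_cast Complex.norm_natCast (n + 1)
  rw [norm_div, norm_pow, norm_pow, hn]
  gcongr
  exact pow_le_one₀ (norm_nonneg x) hx'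

/-- The defining series of `Li_m`, `m ≥ 2`, on the closed unit disc. -/
theorem polylog_eq_tsum_of_norm_le_one {m : ℕ} (hm : 2 ≤ m) {x : ℂ} (hx : ‖x‖ ≤ 1)
    (hc : x ∈ cutPlane) : polylog m x = ∑' n : ℕ, x ^ (n + 1) / ((n : ℂ) + 1) ^ m := by
  have hball : Metric.ball (0 : ℂ) 1 ⊆ cutPlane := by
    intro y hy
    left
    have h1 : ‖y‖ < 1 := by simpa using hy
    have h2 := Complex.re_le_norm y
    simp only [Complex.sub_re, Complex.one_re]
    linarith
  refine Set.EqOn.of_subset_closure (f := polylog m)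
    (g := fun x => ∑' n : ℕ, x ^ (n + 1) / ((n : ℂ) + 1) ^ m) (s := Metric.ball (0 : ℂ) 1)
    (t := Metric.closedBall (0 : ℂ) 1 ∩ cutPlane) ?_ ?_ ?_ ?_ ?_ ⟨by simpa using hx, hc⟩
  · intro y hy
    exact ((polylog_hasSum (by omega) (by simpa using hy)).tsum_eq).symm
  · exact (polylog_differentiableOn m).continuousOn.mono inter_subset_right
  · exact (continuousOn_polylog_series hm).mono inter_subset_left
  · exact subset_inter Metric.ball_subset_closedBall hball
  · rw [closure_ball _ one_ne_zero]
    exact inter_subset_left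

theorem riemannZeta_nat_eq_ofReal {m : ℕ} (hm : 2 ≤ m) :
    riemannZeta m = ((∑' n : ℕ, 1 / ((n : ℝ) + 1) ^ m : ℝ) : ℂ) := by
  have h : Summable fun n : ℕ => 1 / (n : ℂ) ^ m := by
    simpa using Complex.summable_ofReal.mpr
      (Real.summable_one_div_nat_pow.mpr (show 1 < m by omega))
  rw [zeta_nat_eq_tsum_of_gt_one (by omega), h.tsum_eq_zero_add, Complex.ofReal_tsum]
  simp [show m ≠ 0 by omega]

/-- For `m ≥ 2` the series converges uniformly on the closed disc, so its sum is continuous up to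
the point `1`, although `1` is off the cut plane. -/
theorem tendsto_polylog_exp {m : ℕ} (hm : 2 ≤ m) :
    Filter.Tendsto (fun t : ℝ => polylog m (Complex.exp (-2 * Complex.I * t)))
      (nhdsWithin 0 (Ioi 0)) (nhds (riemannZeta m)) := by
  have hn : ∀ t : ℝ, ‖Complex.exp (-2 * Complex.I * t)‖ = 1 := fun t => by
    rw [Complex.norm_exp]; simp
  have h1 : Filter.Tendsto (fun t : ℝ => Complex.exp (-2 * Complex.I * t))
      (nhdsWithin 0 (Ioi 0)) (nhdsWithin 1 (Metric.closedBall 0 1)) := by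
    refine tendsto_nhdsWithin_iff.mpr ⟨?_, Filter.Eventually.of_forall fun t => ?_⟩
    · have h : Continuous fun t : ℝ => Complex.exp (-2 * Complex.I * t) := by fun_prop
      simpa using (h.tendsto 0).mono_left nhdsWithin_le_nhds
    · rw [mem_closedBall_zero_iff, hn t]
  have h2 := ((continuousOn_polylog_series hm) 1 (by simp)).tendsto.comp h1
  have e : ∑' n : ℕ, (1 : ℂ) ^ (n + 1) / ((n : ℂ) + 1) ^ m = riemannZeta m := by
    rw [riemannZeta_nat_eq_ofReal hm, Complex.ofReal_tsum]
    simp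
  rw [e] at h2
  refine h2.congr' ?_
  filter_upwards [Ioo_mem_nhdsGT (show (0 : ℝ) < Real.pi / 2 by positivity)] with t ht
  exact (polylog_eq_tsum_of_norm_le_one hm (hn t).le
    (exp_neg_two_I_mul_mem_cutPlane ht.1 ht.2)).symm

theorem hasDerivAt_polylog_exp (n : ℕ) {t : ℝ} (h0 : 0 < t) (h1 : t < Real.pi / 2) :
    HasDerivAt (fun t : ℝ => polylog (n + 2) (Complex.exp (-2 * Complex.I * t)))
      (-2 * Complex.I * polylog (n + 1) (Complex.exp (-2 * Complex.I * t))) t := by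
  have hne := Complex.exp_ne_zero (-2 * Complex.I * t)
  refine ((hasDerivAt_polylog_add_two n (exp_neg_two_I_mul_mem_cutPlane h0 h1) hne).comp t
    (hasDerivAt_exp_neg_two_I_mul t)).congr_deriv ?_
  field_simp

theorem re_polylog_one_exp {t : ℝ} (h0 : 0 < t) (h1 : t < Real.pi / 2) :
    (polylog 1 (Complex.exp (-2 * Complex.I * t))).re = -Real.log (2 * Real.sin t) := by
  rw [polylog_one (exp_neg_two_I_mul_mem_cutPlane h0 h1), Complex.neg_re, Complex.log_re]
  have h := norm_sineArc t
  rw [sineArc, abs_of_pos (Real.sin_pos_of_pos_of_lt_pi h0 (by linarith [Real.pi_pos]))] at h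
  rw [h]

theorem intervalIntegrable_mul_log_sin_pow {z : ℝ} (h0 : 0 < z) (hz : z < Real.pi / 2) (c : ℝ)
    (n : ℕ) {φ : ℝ → ℝ} (hφ : Continuous φ) :
    IntervalIntegrable (fun t => φ t * (c + Real.log (Real.sin t)) ^ n) volume 0 z := by
  obtain ⟨C, hC, hb⟩ := exists_bound_log_sin_pow (abs_nonneg c) n
  obtain ⟨B, hB⟩ := isCompact_Icc.exists_bound_of_continuousOn (hφ.continuousOn (s := Icc 0 z))
  refine intervalIntegrable_of_le_rpow (C := B * C) h0.le ?_ fun t ht => ?_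
  · refine hφ.continuousOn.mul (ContinuousOn.pow (continuousOn_const.add
      (ContinuousOn.log (by fun_prop) fun t ht => ?_)) n)
    exact sin_ne_zero_of_mem ht.1 (ht.2.trans_lt hz)
  · rw [norm_mul, norm_pow]
    have h1 : ‖c + Real.log (Real.sin t)‖ ^ n ≤ C * t ^ (-(1 / 2) : ℝ) :=
      (pow_le_pow_left₀ (norm_nonneg _) (norm_add_le _ _) n).trans
        (hb t ht.1 (ht.2.trans hz.le))
    have h2 := hB t (Ioc_subset_Icc_self ht)
    calc _ ≤ B * (C * t ^ (-(1 / 2) : ℝ)) :=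
          mul_le_mul h2 h1 (by positivity) ((norm_nonneg _).trans h2)
      _ = _ := by ring

/-- The sextic Clausen value `Im Li₆(e^{-2iz})` as an integral of `log (2 sin t)`. -/
theorem im_polylog_six_exp {z : ℝ} (h0 : 0 < z) (hz : z < Real.pi / 2) :
    2 * ∫ t in (0 : ℝ)..z, (z - t) ^ 4 * Real.log (2 * Real.sin t)
      = 3 / 2 * (polylog 6 (Complex.exp (-2 * Complex.I * z))).im
        - 2 * z ^ 3 * (riemannZeta 3).re + 3 * z * (riemannZeta 5).re := by
  set p : ℕ → ℝ → ℂ := fun m t => polylog m (Complex.exp (-2 * Complex.I * t)) with hp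
  -- The normalisation `j! / (-2i)^j` gives `r (j+1)' = (j+1) * r j`, the recursion of the binomial
  -- sum with `v = z - s`, `-v' = 1`.
  set r : ℕ → ℝ → ℂ := fun j t => (j.factorial : ℂ) / (-2 * Complex.I) ^ j * p (j + 2) t with hr
  set P : ℝ → ℂ := fun s => ∑ j ∈ Finset.range (4 + 1),
    (Nat.choose 4 j : ℂ) * (((z - s : ℝ) : ℂ) ^ (4 - j) * r j s) with hP
  have hI : (-2 * Complex.I) ≠ 0 := by simp
  have hd : ∀ t ∈ Ioc 0 z, HasDerivAt P (((z - t : ℝ) : ℂ) ^ 4 * (-2 * Complex.I * p 1 t)) t := by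
    intro t ht
    have h1 := ht.2.trans_lt hz
    refine hasDerivAt_binomial_sum (((hasDerivAt_id t).const_sub z).ofReal_comp)
      (by simpa [hr, hp] using hasDerivAt_polylog_exp 0 ht.1 h1) (fun j => ?_) 4
    refine ((hasDerivAt_polylog_exp (j + 1) ht.1 h1).const_mul _).congr_deriv ?_
    simp only [hr, hp, Nat.factorial_succ, pow_succ]
    push_cast
    field_simp
  have hdi : ∀ t ∈ Ioc 0 z, HasDerivAt (fun t => (P t).im)
      (2 * ((z - t) ^ 4 * Real.log (2 * Real.sin t))) t := by
    intro t ht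
    refine (Complex.imCLM.hasFDerivAt.comp_hasDerivAt t (hd t ht)).congr_deriv ?_
    have h := re_polylog_one_exp ht.1 (ht.2.trans_lt hz)
    have e : ((z - t : ℝ) : ℂ) ^ 4 * (-2 * Complex.I * p 1 t)
        = ((-2 * (z - t) ^ 4 : ℝ) : ℂ) * (p 1 t * Complex.I) := by push_cast; ring
    rw [Complex.imCLM_apply, e, Complex.im_ofReal_mul, Complex.mul_I_im, h]
    ring
  have hi : IntervalIntegrable (fun t => 2 * ((z - t) ^ 4 * Real.log (2 * Real.sin t)))
      volume 0 z := by
    refine (intervalIntegrable_congr (fun t ht => ?_)).mp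
      (intervalIntegrable_mul_log_sin_pow h0 hz (Real.log 2) 1
        (φ := fun t => 2 * (z - t) ^ 4) (by fun_prop))
    rw [uIoc_of_le h0.le] at ht
    simp only [Real.log_mul two_ne_zero (sin_ne_zero_of_mem ht.1 (ht.2.trans_lt hz))]
    ring
  have hl : Filter.Tendsto P (nhdsWithin 0 (Ioi 0)) (nhds (∑ j ∈ Finset.range (4 + 1),
      (Nat.choose 4 j : ℂ) * (((z - 0 : ℝ) : ℂ) ^ (4 - j) *
        ((j.factorial : ℂ) / (-2 * Complex.I) ^ j * riemannZeta (j + 2 : ℕ))))) := by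
    refine tendsto_finsetSum _ fun j _ => Filter.Tendsto.const_mul _ (Filter.Tendsto.mul ?_ ?_)
    · have hcont : Continuous fun s : ℝ => ((z - s : ℝ) : ℂ) ^ (4 - j) := by fun_prop
      exact (hcont.tendsto 0).mono_left nhdsWithin_le_nhds
    · exact (tendsto_polylog_exp (by omega)).const_mul _
  have hzr : Filter.Tendsto (fun t => (P t).im) (nhdsWithin z (Iio z)) (nhds (P z).im) :=
    (hdi z ⟨h0, le_rfl⟩).continuousAt.tendsto.mono_left nhdsWithin_le_nhds
  rw [← intervalIntegral.integral_const_mul,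
    intervalIntegral.integral_eq_sub_of_hasDerivAt_of_tendsto h0
      (fun t ht => hdi t (Ioo_subset_Ioc_self ht)) hi
      ((Complex.continuous_im.tendsto _).comp hl) hzr]
  have hreal : ∀ m : ℕ, 2 ≤ m → ∃ a : ℝ, riemannZeta m = a := fun m hm =>
    ⟨_, riemannZeta_nat_eq_ofReal hm⟩
  obtain ⟨a2, h2⟩ := hreal 2 le_rfl
  obtain ⟨a3, h3⟩ := hreal 3 (by norm_num)
  obtain ⟨a4, h4⟩ := hreal 4 (by norm_num)
  obtain ⟨a5, h5⟩ := hreal 5 (by norm_num)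
  obtain ⟨a6, h6⟩ := hreal 6 (by norm_num)
  have i2 : (-2 * Complex.I) ^ 2 = -4 := by linear_combination 4 * Complex.I_sq
  have i3 : (-2 * Complex.I) ^ 3 = 8 * Complex.I := by
    linear_combination (-8 * Complex.I) * Complex.I_sq
  have i4 : (-2 * Complex.I) ^ 4 = 16 := by
    linear_combination (16 * Complex.I ^ 2 - 16) * Complex.I_sq
  have e1 : P z = ((3 / 2 : ℝ) : ℂ) * p 6 z := by
    simp [hP, hr, Finset.sum_range_succ, Nat.factorial, -neg_mul, i4]
    norm_num
  -- Zeta values at integers are real and `(-2i)^j` is real exactly for even `j`, so only `ζ(3)` and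
  -- `ζ(5)` enter the imaginary part.
  have e2 : ∑ j ∈ Finset.range (4 + 1),
      (Nat.choose 4 j : ℂ) * (((z - 0 : ℝ) : ℂ) ^ (4 - j) *
        ((j.factorial : ℂ) / (-2 * Complex.I) ^ j * riemannZeta (j + 2 : ℕ)))
      = ((z ^ 4 * a2 - 3 * z ^ 2 * a4 + 3 / 2 * a6 : ℝ) : ℂ)
        + ((2 * z ^ 3 * a3 - 3 * z * a5 : ℝ) : ℂ) * Complex.I := by
    have c1 : Nat.choose 4 1 = 4 := rfl
    have c2 : Nat.choose 4 2 = 6 := rfl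
    have c3 : Nat.choose 4 3 = 4 := rfl
    have f3 : Nat.factorial 3 = 6 := rfl
    have f4 : Nat.factorial 4 = 24 := rfl
    simp only [Finset.sum_range_succ, Finset.range_zero, Finset.sum_empty, zero_add,
      Nat.reduceAdd, Nat.reduceSub, h2, h3, h4, h5, h6, i2, i3, i4, pow_zero, pow_one, sub_zero,
      Nat.choose_zero_right, Nat.choose_self, c1, c2, c3, Nat.factorial_zero, Nat.factorial_one,
      Nat.factorial_two, f3, f4]
    push_cast
    field_simp
    linear_combination (3072 * (z : ℂ) * a5 - 2048 * (z : ℂ) ^ 3 * a3) * Complex.I_sq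
  have h3' : riemannZeta 3 = a3 := by exact_mod_cast h3
  have h5' : riemannZeta 5 = a5 := by exact_mod_cast h5
  rw [e1, e2, h3', h5', Complex.im_ofReal_mul, Complex.add_im, Complex.ofReal_im,
    Complex.im_ofReal_mul, Complex.I_im]
  simp only [hp, Complex.ofReal_re]
  ring

/-! ### Real and imaginary parts of the arc integrals. -/

/-- `log (sin t / sin z)`, the kernel of the log-sine integrals. -/
noncomputable def logSinRatio (z t : ℝ) : ℝ := Real.log (Real.sin t / Real.sin z)

theorem logSinRatio_eq {z t : ℝ} (h0 : 0 < t) (h1 : t ≤ z) (hz : z < Real.pi / 2) :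
    logSinRatio z t = Real.log (Real.sin t) - Real.log (Real.sin z) :=
  Real.log_div (sin_ne_zero_of_mem h0 (h1.trans_lt hz))
    (sin_ne_zero_of_mem (h0.trans_le h1) hz)

theorem sineArcLog_sub_eq {z t : ℝ} (h0 : 0 < t) (h1 : t ≤ z) (hz : z < Real.pi / 2) :
    sineArcLog z - sineArcLog t = ⟨-logSinRatio z t, -(z - t)⟩ := by
  rw [logSinRatio_eq h0 h1 hz]
  apply Complex.ext <;>
    simp [sineArcLog]
  ring

theorem intervalIntegrable_logSinRatio {z : ℝ} (h0 : 0 < z) (hz : z < Real.pi / 2) (n : ℕ)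
    {φ : ℝ → ℝ} (hφ : Continuous φ) :
    IntervalIntegrable (fun t => φ t * logSinRatio z t ^ n) volume 0 z := by
  refine (intervalIntegrable_congr (fun t ht => ?_)).mp
    (intervalIntegrable_mul_log_sin_pow h0 hz (-Real.log (Real.sin z)) n hφ)
  rw [uIoc_of_le h0.le] at ht
  simp only [logSinRatio_eq ht.1 ht.2 hz]
  ring

/-- Any continuous real-linear functional of an arc integral is a real integral. -/
theorem clm_arc_integral {z : ℝ} (h0 : 0 < z) (hz : z < Real.pi / 2) (L : ℂ →L[ℝ] ℝ) (n : ℕ)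
    {φ : ℝ → ℂ} (hφ : Continuous φ) {q : ℝ → ℝ}
    (hq : ∀ t, L ((⟨-logSinRatio z t, -(z - t)⟩ : ℂ) ^ n * φ t) = q t) :
    IntervalIntegrable q volume 0 z ∧
    L (∫ t in (0 : ℝ)..z, (sineArcLog z - sineArcLog t) ^ n * φ t) = ∫ t in (0 : ℝ)..z, q t := by
  have hi := intervalIntegrable_sineArcLog_pow_mul h0.le hz n (hφ.continuousOn (s := Icc 0 z))
  have hc : ∀ t ∈ uIoc 0 z, L ((sineArcLog z - sineArcLog t) ^ n * φ t) = q t := fun t ht => by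
    rw [uIoc_of_le h0.le] at ht
    rw [sineArcLog_sub_eq ht.1 ht.2 hz, hq]
  constructor
  · refine (intervalIntegrable_congr hc).mp ?_
    exact ⟨L.integrable_comp hi.1, L.integrable_comp hi.2⟩
  · rw [← L.intervalIntegral_comp_comm hi]
    exact intervalIntegral.integral_congr_ae (Filter.Eventually.of_forall hc)

/-- This and the next six lemmas expand `(-L - i (z - t))^n`. The prefactor, `2i / n!` for
`Li_{n+1}` and `-4 / n!` for `S_{n,2}`, is absorbed into `φ`. -/
theorem im_polylog_three {z : ℝ} (h0 : 0 < z) (hz : z < Real.pi / 2) :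
    IntervalIntegrable (fun t => logSinRatio z t ^ 2 - (z - t) ^ 2) volume 0 z ∧
    (polylog 3 (sineArc z)).im = ∫ t in (0 : ℝ)..z, (logSinRatio z t ^ 2 - (z - t) ^ 2) := by
  have h := clm_arc_integral h0 hz Complex.imCLM 2 (φ := fun _ => Complex.I) (by fun_prop)
    (q := fun t => logSinRatio z t ^ 2 - (z - t) ^ 2) (fun t => by simp [pow_succ]; ring)
  refine ⟨h.1, ?_⟩
  rw [← h.2, polylog_sineArc 2 h0 hz, intervalIntegral.integral_mul_const, Complex.imCLM_apply]
  congr 1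
  simp
  ring

theorem re_polylog_four {z : ℝ} (h0 : 0 < z) (hz : z < Real.pi / 2) :
    IntervalIntegrable (fun t => logSinRatio z t ^ 2 * (z - t) - (z - t) ^ 3 / 3) volume 0 z ∧
    (polylog 4 (sineArc z)).re
      = ∫ t in (0 : ℝ)..z, (logSinRatio z t ^ 2 * (z - t) - (z - t) ^ 3 / 3) := by
  have h := clm_arc_integral h0 hz Complex.reCLM 3 (φ := fun _ => Complex.I / 3) (by fun_prop)
    (q := fun t => logSinRatio z t ^ 2 * (z - t) - (z - t) ^ 3 / 3)
    (fun t => by simp [pow_succ]; ring)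
  refine ⟨h.1, ?_⟩
  rw [← h.2, polylog_sineArc 3 h0 hz, intervalIntegral.integral_mul_const, Complex.reCLM_apply,
    show Nat.factorial 3 = 6 from rfl]
  congr 1
  push_cast
  ring

theorem im_polylog_five {z : ℝ} (h0 : 0 < z) (hz : z < Real.pi / 2) :
    IntervalIntegrable (fun t => (logSinRatio z t ^ 4 - 6 * logSinRatio z t ^ 2 * (z - t) ^ 2
      + (z - t) ^ 4) / 12) volume 0 z ∧
    (polylog 5 (sineArc z)).im = ∫ t in (0 : ℝ)..z, (logSinRatio z t ^ 4
      - 6 * logSinRatio z t ^ 2 * (z - t) ^ 2 + (z - t) ^ 4) / 12 := by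
  have h := clm_arc_integral h0 hz Complex.imCLM 4 (φ := fun _ => Complex.I / 12) (by fun_prop)
    (q := fun t => (logSinRatio z t ^ 4 - 6 * logSinRatio z t ^ 2 * (z - t) ^ 2
      + (z - t) ^ 4) / 12) (fun t => by simp [pow_succ]; ring)
  refine ⟨h.1, ?_⟩
  rw [← h.2, polylog_sineArc 4 h0 hz, intervalIntegral.integral_mul_const, Complex.imCLM_apply,
    show Nat.factorial 4 = 24 from rfl]
  congr 1
  push_cast
  ring

theorem re_polylog_five {z : ℝ} (h0 : 0 < z) (hz : z < Real.pi / 2) :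
    IntervalIntegrable (fun t => -(logSinRatio z t ^ 3 * (z - t)
      - logSinRatio z t * (z - t) ^ 3) / 3) volume 0 z ∧
    (polylog 5 (sineArc z)).re = ∫ t in (0 : ℝ)..z, -(logSinRatio z t ^ 3 * (z - t)
      - logSinRatio z t * (z - t) ^ 3) / 3 := by
  have h := clm_arc_integral h0 hz Complex.reCLM 4 (φ := fun _ => Complex.I / 12) (by fun_prop)
    (q := fun t => -(logSinRatio z t ^ 3 * (z - t) - logSinRatio z t * (z - t) ^ 3) / 3)
    (fun t => by simp [pow_succ]; ring)
  refine ⟨h.1, ?_⟩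
  rw [← h.2, polylog_sineArc 4 h0 hz, intervalIntegral.integral_mul_const, Complex.reCLM_apply,
    show Nat.factorial 4 = 24 from rfl]
  congr 1
  push_cast
  ring

theorem im_polylog_six {z : ℝ} (h0 : 0 < z) (hz : z < Real.pi / 2) :
    IntervalIntegrable (fun t => -(logSinRatio z t ^ 5 - 10 * logSinRatio z t ^ 3 * (z - t) ^ 2
      + 5 * logSinRatio z t * (z - t) ^ 4) / 60) volume 0 z ∧
    (polylog 6 (sineArc z)).im = ∫ t in (0 : ℝ)..z, -(logSinRatio z t ^ 5
      - 10 * logSinRatio z t ^ 3 * (z - t) ^ 2 + 5 * logSinRatio z t * (z - t) ^ 4) / 60 := by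
  have h := clm_arc_integral h0 hz Complex.imCLM 5 (φ := fun _ => Complex.I / 60) (by fun_prop)
    (q := fun t => -(logSinRatio z t ^ 5 - 10 * logSinRatio z t ^ 3 * (z - t) ^ 2
      + 5 * logSinRatio z t * (z - t) ^ 4) / 60) (fun t => by simp [pow_succ]; ring)
  refine ⟨h.1, ?_⟩
  rw [← h.2, polylog_sineArc 5 h0 hz, intervalIntegral.integral_mul_const, Complex.imCLM_apply,
    show Nat.factorial 5 = 120 from rfl]
  congr 1
  push_cast
  ring

theorem im_nielsenS_three_two {z : ℝ} (h0 : 0 < z) (hz : z < Real.pi / 2) :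
    IntervalIntegrable (fun t => 2 / 3 * (t * (3 * logSinRatio z t ^ 2 * (z - t) - (z - t) ^ 3)))
      volume 0 z ∧
    (nielsenS 3 2 (sineArc z)).im = ∫ t in (0 : ℝ)..z,
      2 / 3 * (t * (3 * logSinRatio z t ^ 2 * (z - t) - (z - t) ^ 3)) := by
  have h := clm_arc_integral h0 hz Complex.imCLM 3 (φ := fun t => (t : ℂ) * (-2 / 3))
    (by fun_prop)
    (q := fun t => 2 / 3 * (t * (3 * logSinRatio z t ^ 2 * (z - t) - (z - t) ^ 3)))
    (fun t => by simp [pow_succ]; ring)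
  refine ⟨h.1, ?_⟩
  rw [← h.2, nielsenS_two_sineArc 2 h0 hz, Complex.imCLM_apply]
  simp_rw [← mul_assoc]
  rw [intervalIntegral.integral_mul_const, show Nat.factorial (2 + 1) = 6 from rfl]
  congr 1
  push_cast
  ring

theorem im_nielsenS_four_two {z : ℝ} (h0 : 0 < z) (hz : z < Real.pi / 2) :
    IntervalIntegrable (fun t => -(2 / 3) * (t * (logSinRatio z t ^ 3 * (z - t)
      - logSinRatio z t * (z - t) ^ 3))) volume 0 z ∧
    (nielsenS 4 2 (sineArc z)).im = ∫ t in (0 : ℝ)..z, -(2 / 3) * (t *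
      (logSinRatio z t ^ 3 * (z - t) - logSinRatio z t * (z - t) ^ 3)) := by
  have h := clm_arc_integral h0 hz Complex.imCLM 4 (φ := fun t => (t : ℂ) * (-1 / 6))
    (by fun_prop)
    (q := fun t => -(2 / 3) * (t * (logSinRatio z t ^ 3 * (z - t)
      - logSinRatio z t * (z - t) ^ 3)))
    (fun t => by simp [pow_succ]; ring)
  refine ⟨h.1, ?_⟩
  rw [← h.2, nielsenS_two_sineArc 3 h0 hz, Complex.imCLM_apply]
  simp_rw [← mul_assoc]
  rw [intervalIntegral.integral_mul_const, show Nat.factorial (3 + 1) = 24 from rfl]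
  congr 1
  push_cast
  ring

/-! ### Linear combinations of the integrands. -/

theorem logSine_eq_integral_logSinRatio (m k : ℕ) (z : ℝ) :
    logSine m k z = -∫ t in (0 : ℝ)..z, t ^ k * logSinRatio z t ^ (m - 1 - k) := rfl

theorem integral_sub_pow (z : ℝ) (n : ℕ) :
    ∫ t in (0 : ℝ)..z, (z - t) ^ n = z ^ (n + 1) / (n + 1) := by
  rw [intervalIntegral.integral_comp_sub_left (fun x => x ^ n) z, integral_pow]
  simp

/-- With `w = z - t`, the `L^2` terms cancel because `t w + w^2 - z w = 0`. The pure powers of `w`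
add up to `w^4`, whose integral is the term `z^5 / 5`. -/
theorem logSine_five_zero {z : ℝ} (h0 : 0 < z) (hz : z < Real.pi / 2) :
    logSine 5 0 z = -(z ^ 5 / 5) + 3 * (nielsenS 3 2 (sineArc z)).im
      - 12 * (polylog 5 (sineArc z)).im - 6 * z * (polylog 4 (sineArc z)).re := by
  obtain ⟨i1, e1⟩ := im_nielsenS_three_two h0 hz
  obtain ⟨i2, e2⟩ := im_polylog_five h0 hz
  obtain ⟨i3, e3⟩ := re_polylog_four h0 hz
  have i4 : IntervalIntegrable (fun t => (z - t) ^ 4) volume 0 z :=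
    Continuous.intervalIntegrable (by fun_prop) _ _
  have h := intervalIntegral.integral_sub (((i1.const_mul 3).sub (i2.const_mul 12)).sub
    (i3.const_mul (6 * z))) i4
  rw [intervalIntegral.integral_sub ((i1.const_mul 3).sub (i2.const_mul 12))
      (i3.const_mul (6 * z)), intervalIntegral.integral_sub (i1.const_mul 3) (i2.const_mul 12)] at h
  simp only [intervalIntegral.integral_const_mul, integral_sub_pow] at h e1
  rw [← e1, ← e2, ← e3] at h
  rw [logSine_eq_integral_logSinRatio, ← intervalIntegral.integral_neg]
  refine Eq.trans (intervalIntegral.integral_congr fun t _ => ?_) (h.trans ?_)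
  · simp only [Nat.reduceSub]
    ring
  · push_cast
    ring

/-- The coefficient of `L^2` is `t (z - t) + z (z - t) - z^2 = -t^2`. -/
theorem logSine_five_two {z : ℝ} (h0 : 0 < z) (hz : z < Real.pi / 2) :
    logSine 5 2 z = -(7 * z ^ 5 / 30) + 1 / 2 * (nielsenS 3 2 (sineArc z)).im
      + z * (polylog 4 (sineArc z)).re - z ^ 2 * (polylog 3 (sineArc z)).im := by
  obtain ⟨i1, e1⟩ := im_nielsenS_three_two h0 hz
  obtain ⟨i2, e2⟩ := re_polylog_four h0 hz
  obtain ⟨i3, e3⟩ := im_polylog_three h0 hz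
  have i4 : ∀ (c : ℝ) (n : ℕ), IntervalIntegrable (fun t => c * (z - t) ^ n) volume 0 z :=
    fun c n => Continuous.intervalIntegrable (by fun_prop) _ _
  have j1 := (i1.const_mul (1 / 2)).add (i2.const_mul z)
  have j2 := j1.sub (i3.const_mul (z ^ 2))
  -- The remaining powers of `z - t` are removed by three corrections, with total integral `-1/3 +
  -- 1/6 - 1/15 = -7/30` times `z^5`.
  have j3 := j2.sub (i4 (z ^ 2) 2)
  have j4 := j3.add (i4 (2 / 3 * z) 3)
  have h := intervalIntegral.integral_sub j4 (i4 (1 / 3) 4)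
  rw [intervalIntegral.integral_add j3 (i4 (2 / 3 * z) 3),
    intervalIntegral.integral_sub j2 (i4 (z ^ 2) 2),
    intervalIntegral.integral_sub j1 (i3.const_mul (z ^ 2)),
    intervalIntegral.integral_add (i1.const_mul (1 / 2)) (i2.const_mul z)] at h
  simp only [intervalIntegral.integral_const_mul, integral_sub_pow] at h e1
  rw [← e1, ← e2, ← e3] at h
  rw [logSine_eq_integral_logSinRatio, ← intervalIntegral.integral_neg]
  refine Eq.trans (intervalIntegral.integral_congr fun t _ => ?_) (h.trans ?_)
  · simp only [Nat.reduceSub]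
    ring
  · push_cast
    ring

/-- `L` differs from `log (2 sin t)` by the constant `log (2 sin z)`; this is the source of the
logarithmic term in weight six. -/
theorem integral_sub_pow_mul_logSinRatio {z : ℝ} (h0 : 0 < z) (hz : z < Real.pi / 2) :
    ∫ t in (0 : ℝ)..z, (z - t) ^ 4 * logSinRatio z t
      = (∫ t in (0 : ℝ)..z, (z - t) ^ 4 * Real.log (2 * Real.sin t))
        - Real.log (2 * Real.sin z) * z ^ 5 / 5 := by
  have hi := intervalIntegrable_logSinRatio h0 hz 1 (φ := fun t => (z - t) ^ 4) (by fun_prop)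
  simp only [pow_one] at hi
  have hj : IntervalIntegrable (fun t => Real.log (2 * Real.sin z) * (z - t) ^ 4) volume 0 z :=
    Continuous.intervalIntegrable (by fun_prop) _ _
  have h := intervalIntegral.integral_add hi hj
  rw [intervalIntegral.integral_const_mul, integral_sub_pow] at h
  have e : ∫ t in (0 : ℝ)..z, (z - t) ^ 4 * Real.log (2 * Real.sin t)
      = ∫ t in (0 : ℝ)..z, ((z - t) ^ 4 * logSinRatio z t
        + Real.log (2 * Real.sin z) * (z - t) ^ 4) := by
    refine intervalIntegral.integral_congr_ae (Filter.Eventually.of_forall fun t ht => ?_)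
    rw [uIoc_of_le h0.le] at ht
    rw [logSinRatio_eq ht.1 ht.2 hz,
      Real.log_mul two_ne_zero (sin_ne_zero_of_mem ht.1 (ht.2.trans_lt hz)),
      Real.log_mul two_ne_zero (sin_ne_zero_of_mem h0 hz)]
    ring
  rw [e, h]
  push_cast
  ring

/-- With `w = z - t`, the `L^3` terms cancel because `w^2 + t w - z w = 0`, while the terms linear
in `L` leave `5 w^4 L`, which is subtracted and evaluated separately. -/
theorem logSine_six_zero {z : ℝ} (h0 : 0 < z) (hz : z < Real.pi / 2) :
    logSine 6 0 z = z ^ 5 * Real.log (2 * Real.sin z) + 5 * z ^ 3 * (riemannZeta 3).re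
      - 15 * z / 2 * (riemannZeta 5).re - 15 * (nielsenS 4 2 (sineArc z)).im
      - 15 / 4 * ((polylog 6 (Complex.exp (-2 * Complex.I * z))).im
        - 16 * (polylog 6 (sineArc z)).im) + 30 * z * (polylog 5 (sineArc z)).re := by
  obtain ⟨i1, e1⟩ := im_nielsenS_four_two h0 hz
  obtain ⟨i2, e2⟩ := im_polylog_six h0 hz
  obtain ⟨i3, e3⟩ := re_polylog_five h0 hz
  have i4 := intervalIntegrable_logSinRatio h0 hz 1 (φ := fun t => (z - t) ^ 4) (by fun_prop)
  simp only [pow_one] at i4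
  have h := intervalIntegral.integral_sub (((i2.const_mul 60).sub (i1.const_mul 15)).add
    (i3.const_mul (30 * z))) (i4.const_mul 5)
  rw [intervalIntegral.integral_add ((i2.const_mul 60).sub (i1.const_mul 15))
      (i3.const_mul (30 * z)), intervalIntegral.integral_sub (i2.const_mul 60) (i1.const_mul 15)] at h
  simp only [intervalIntegral.integral_const_mul] at h e1
  rw [← e1, ← e2, ← e3, integral_sub_pow_mul_logSinRatio h0 hz] at h
  rw [logSine_eq_integral_logSinRatio, ← intervalIntegral.integral_neg]
  refine Eq.trans (intervalIntegral.integral_congr fun t _ => ?_) (h.trans ?_)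
  · simp only [Nat.reduceSub]
    ring
  · linear_combination (-5 / 2) * im_polylog_six_exp h0 hz

theorem mainTheorem7 (z : ℝ) (hz₀ : 0 < z) (hz₁ : z < Real.pi / 2) :
    logSine 5 0 z
        = -(z ^ 5 / 5)
          + 3 * (nielsenS 3 2 (1 - Complex.exp (-2 * Complex.I * z))).im
          - 12 * (polylog 5 (1 - Complex.exp (-2 * Complex.I * z))).im
          - 6 * z * (polylog 4 (1 - Complex.exp (-2 * Complex.I * z))).re ∧
    logSine 5 2 z
        = -(7 * z ^ 5 / 30)
          + 1 / 2 * (nielsenS 3 2 (1 - Complex.exp (-2 * Complex.I * z))).im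
          + z * (polylog 4 (1 - Complex.exp (-2 * Complex.I * z))).re
          - z ^ 2 * (polylog 3 (1 - Complex.exp (-2 * Complex.I * z))).im ∧
    logSine 6 0 z
        = z ^ 5 * Real.log (2 * Real.sin z)
          + 5 * z ^ 3 * (riemannZeta 3).re
          - 15 * z / 2 * (riemannZeta 5).re
          - 15 * (nielsenS 4 2 (1 - Complex.exp (-2 * Complex.I * z))).im
          - 15 / 4 * ((polylog 6 (Complex.exp (-2 * Complex.I * z))).im
              - 16 * (polylog 6 (1 - Complex.exp (-2 * Complex.I * z))).im)
          + 30 * z * (polylog 5 (1 - Complex.exp (-2 * Complex.I * z))).re := by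
  
  exact ⟨logSine_five_zero hz₀ hz₁, logSine_five_two hz₀ hz₁, logSine_six_zero hz₀ hz₁⟩
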